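/- Let $\mathcal A,\mathcal B,\mathcal X,\mathcal Y$ be finite non-empty sets, $u=(u_{ab})_{a\in\mathcal A,b\in\mathcal B}$ a real payoff table, and $p_{XY}$ a probability mass function on $\mathcal X\times\mathcal Y$. In the $n$-stage repeated game with leaked randomness source, pairs $(X_1,Y_1),\dots,(X_n,Y_n)$ are drawn i.i.d. from $p_{XY}$. At stage $t$ Alice observes $X_t$ and Bob observes $Y_t$; then they simultaneously choose actions $A_t=\sigma_t(X_1,\dots,X_t,A_1,B_1,\dots,A_{t-1},B_{t-1})\in\mathcal A$ and $B_t=\tau_t(Y_1,\dots,Y_t,A_1,B_1,\dots,A_{t-1},B_{t-1})\in\mathcal B$, where $\sigma_t,\tau_t$ are deterministic functions, and both observe $(A_t,B_t)$. The strategies are $\sigma^n=(\sigma_1,\dots,\sigma_n)$ and $\tau^n=(\tau_1,\dots,\tau_n)$, and $\lambda(\sigma^n,\tau^n)=\mathbb E\big[\frac1n\sum_{t=1}^n u_{A_tB_t}\big]$ is the expected average payoff, which Alice maximizes and Bob minimizes. A profile $(\sigma^n,\tau^n)$ is an $(\epsilon,\epsilon')$-Nash equilibrium if $\lambda(\hat\sigma^n,\tau^n)-\lambda(\sigma^n,\tau^n)\le\epsilon$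 for every strategy $\hat\sigma^n$ of Alice and $\lambda(\sigma^n,\tau^n)-\lambda(\sigma^n,\hat\tau^n)\le\epsilon'$ for every strategy $\hat\tau^n$ of Bob. We say that $(\epsilon_A,\epsilon_B)$-Nash equilibrium is achievable in long run if for every $\delta>0$ there is $n_0$ such that for every $n\ge n_0$ the $n$-stage game has an $(\epsilon_A+\delta,\epsilon_B+\delta)$-Nash equilibrium. Let $H$ denote Shannon entropy in bits and, for $\mathsf h\ge0$, put $$\mathcal J^{(A)}(\mathsf h)=\max_{p_A\in\Delta(\mathcal A),\,H(p_A)\le\mathsf h}\ \min_{b\in\mathcal B}\sum_{a\in\mathcal A}p_A(a)u_{ab},\qquad \mathcal J^{(B)}(\mathsf h)=\min_{p_B\in\Delta(\mathcal B),\,H(p_B)\le\mathsf h}\ \max_{a\in\mathcal A}\sum_{b\in\mathcal B}p_B(b)u_{ab},$$ where $\Delta(\cdot)$ is the set of probability mass functions. Let $\mathcal J^{(A)}_{cav}$ be the upper concave envelope of $\mathcal J^{(A)}$ on $[0,\infty)$ (the pointwise infimum of the concave functions above it) and $\mathcal J^{(B)}_{vex}$ the lower convex envelope of $\mathcal J^{(B)}$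 on $[0,\infty)$ (the pointwise supremum of the convex functions below it). Then, for all real $\epsilon_A,\epsilon_B\ge0$, $(\epsilon_A,\epsilon_B)$-Nash equilibrium is achievable in long run if and only if $$\epsilon_A+\epsilon_B\ \ge\ \mathcal J^{(B)}_{vex}(H(Y|X))-\mathcal J^{(A)}_{cav}(H(X|Y)),$$ where $H(X|Y)$ and $H(Y|X)$ are the conditional Shannon entropies (in bits) under $p_{XY}$. -/

import Mathlib

namespace LeakedGame

/-- Shannon entropy, in bits, of a pmf on a finite alphabet (with `0 log 0 = 0`). -/
noncomputable def entropy {S : Type*} [Fintype S] (q : S → ℝ) : ℝ :=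
  ∑ s, -(q s * Real.logb 2 (q s))

/-- Conditional Shannon entropy `H(S | T)`, in bits, of a joint pmf on `S × T`:
`∑ -p(s,t) log (p(s,t) / p_T(t))`. The terms with `p_T(t) = 0` have `p(s,t) = 0` and vanish. -/
noncomputable def condEntropy {S T : Type*} [Fintype S] [Fintype T] (p : S × T → ℝ) : ℝ :=
  ∑ s, ∑ t, -(p (s, t) * Real.logb 2 (p (s, t) / ∑ s', p (s', t)))

/-- A (deterministic) strategy in the `n`-stage game for a player who observes signals in `S`
and has action set `C`. Stages are numbered from `0`: at stage `t` the action is a function of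
the `t` past action pairs and of the `t + 1` own signals observed so far. -/
def Strategy (A B S C : Type*) (n : ℕ) : Type _ :=
  (t : Fin n) → (Fin t → A × B) → (Fin (t + 1) → S) → C

/-- The action pairs of the first `t` stages that result from the strategies `σ`, `τ` when the
outcomes of the two randomness sources are `ω`. -/
def play {A B X Y : Type*} {n : ℕ} (σ : Strategy A B X A n) (τ : Strategy A B Y B n)
    (ω : Fin n → X × Y) : (t : ℕ) → t ≤ n → Fin t → A × B
  | 0, _ => Fin.elim0
  | t + 1, h =>
    let past : Fin t → A × B := play σ τ ω t (Nat.le_of_succ_le h)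
    Fin.snoc (α := fun _ => A × B) past
      (σ ⟨t, h⟩ past (fun i => (ω (Fin.castLE h i)).1),
        τ ⟨t, h⟩ past (fun i => (ω (Fin.castLE h i)).2))

/-- The expected average payoff `λ(σ, τ)` of the `n`-stage game, for i.i.d. draws of the sources
according to `p`. -/
noncomputable def expectedPayoff {A B X Y : Type*} [Fintype X] [Fintype Y] (u : A → B → ℝ)
    (p : X × Y → ℝ) {n : ℕ} (σ : Strategy A B X A n) (τ : Strategy A B Y B n) : ℝ :=
  ∑ ω : Fin n → X × Y, (∏ t, p (ω t)) *
    ((1 / (n : ℝ)) * ∑ t : Fin n, u (play σ τ ω n le_rfl t).1 (play σ τ ω n le_rfl t).2)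

/-- `(σ, τ)` is an `(εA, εB)`-Nash equilibrium of the `n`-stage game: Alice (the maximizer) cannot
increase the expected average payoff by more than `εA`, and Bob (the minimizer) cannot decrease it
by more than `εB`, by a unilateral change of strategy. -/
def IsApproxNash {A B X Y : Type*} [Fintype X] [Fintype Y] (u : A → B → ℝ)
    (p : X × Y → ℝ) (εA εB : ℝ) {n : ℕ} (σ : Strategy A B X A n) (τ : Strategy A B Y B n) :
    Prop :=
  (∀ σ' : Strategy A B X A n, expectedPayoff u p σ' τ - expectedPayoff u p σ τ ≤ εA) ∧
    ∀ τ' : Strategy A B Y B n, expectedPayoff u p σ τ - expectedPayoff u p σ τ' ≤ εB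

/-- `(εA, εB)`-Nash equilibrium is achievable in long run. -/
def NashAchievable {A B X Y : Type*} [Fintype X] [Fintype Y] (u : A → B → ℝ)
    (p : X × Y → ℝ) (εA εB : ℝ) : Prop :=
  ∀ δ : ℝ, 0 < δ → ∃ n₀ : ℕ, ∀ n : ℕ, n₀ ≤ n →
    ∃ (σ : Strategy A B X A n) (τ : Strategy A B Y B n),
      IsApproxNash u p (εA + δ) (εB + δ) σ τ

/-- Security level of the mixed action `q` of Alice: `min_b ∑_a q(a) u(a,b)`. -/
noncomputable def securityA {A B : Type*} [Fintype A] [Fintype B] [Nonempty B] (u : A → B → ℝ)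
    (q : A → ℝ) : ℝ :=
  Finset.univ.inf' Finset.univ_nonempty fun b => ∑ a, q a * u a b

/-- Security level of the mixed action `q` of Bob: `max_a ∑_b q(b) u(a,b)`. -/
noncomputable def securityB {A B : Type*} [Fintype A] [Fintype B] [Nonempty A] (u : A → B → ℝ)
    (q : B → ℝ) : ℝ :=
  Finset.univ.sup' Finset.univ_nonempty fun a => ∑ b, q b * u a b

/-- The best security level of Alice over mixed actions of entropy at most `h` (for `0 ≤ h`). -/
noncomputable def valueA {A B : Type*} [Fintype A] [Fintype B] [Nonempty B] (u : A → B → ℝ)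
    (h : ℝ) : ℝ :=
  sSup (securityA u '' {q | q ∈ stdSimplex ℝ A ∧ entropy q ≤ h})

/-- The best security level of Bob over mixed actions of entropy at most `h` (for `0 ≤ h`). -/
noncomputable def valueB {A B : Type*} [Fintype A] [Fintype B] [Nonempty A] (u : A → B → ℝ)
    (h : ℝ) : ℝ :=
  sInf (securityB u '' {q | q ∈ stdSimplex ℝ B ∧ entropy q ≤ h})

/-- The upper concave envelope of `f` on `[0, ∞)`: the pointwise infimum of all concave functions
on `[0, ∞)` that lie above `f` there. -/
noncomputable def upperConcaveEnvelope (f : ℝ → ℝ) (h : ℝ) : ℝ :=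
  sInf {y | ∃ g : ℝ → ℝ, ConcaveOn ℝ (Set.Ici 0) g ∧ (∀ x ∈ Set.Ici (0 : ℝ), f x ≤ g x) ∧
    y = g h}

/-- The lower convex envelope of `f` on `[0, ∞)`: the pointwise supremum of all convex functions
on `[0, ∞)` that lie below `f` there. -/
noncomputable def lowerConvexEnvelope (f : ℝ → ℝ) (h : ℝ) : ℝ :=
  sSup {y | ∃ g : ℝ → ℝ, ConvexOn ℝ (Set.Ici 0) g ∧ (∀ x ∈ Set.Ici (0 : ℝ), g x ≤ f x) ∧
    y = g h}

end LeakedGame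

/-! Write `J` for the concave envelope of `valueA u` at `H(X|Y)` and `J'` for the same quantity in
the game with the players exchanged and payoff `-u`. The convex envelope in the statement is `-J'`,
so the claim is that achievability means `-J' - J ≤ εA + εB`. Thanks to `totalPayoff_swap`,
everything below is proved for Alice only.

Necessity. Suppose `securityA u q ≤ d + c * entropy q` for all mixed actions, with `c ≥ 0`. Given a
strategy of Alice, Bob best-responds at each stage to the conditional law of her action given what
he knows. That stage yields at most `d` plus `c` times the entropy her action discloses. His
uncertainty about her signals grows by `H(X|Y)` per stage and cannot become negative, so the average
payoff is at most `d + c * H(X|Y)` (`exists_totalPayoff_le`). A supporting line at `H(X|Y)` brings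
this bound close to `J`. An approximate equilibrium therefore pays about `J + εB` at most and,
symmetrically, `-J' - εA` at least.

Sufficiency. Alternating between mixed actions gives average security arbitrarily close to `J` at an
average entropy strictly below `H(X|Y)`, if the latter is positive
(`exists_sustainable_of_lt_envelope`). Random coding then turns a long block of Alice's signals into
actions that look nearly independent with the prescribed laws, even given Bob's signals
(`exists_block_code`). Playing in each block the code of the preceding block's signals secures
nearly `J` (`exists_securing_strategy`); if `H(X|Y) = 0`, a constant action does. In particular `J ≤
-J'`. Finally the players follow a deterministic path with average payoff `v`, where `max J (-J' -
εA) ≤ v ≤ min (-J') (J + εB)`, and answer any deviation with the securing strategies (`trigger`). -/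

namespace LeakedGame

/-! ### Strategies decomposed at their first stage -/

namespace Strategy

variable {A B S C : Type*} {n : ℕ}

/-- The first action, as a function of the first signal. -/
def first (σ : Strategy A B S C (n + 1)) (s : S) : C :=
  σ ⟨0, n.succ_pos⟩ Fin.elim0 fun _ => s

/-- The strategy for the remaining stages, given the first signal and the first action pair. -/
def next (σ : Strategy A B S C (n + 1)) (s : S) (c : A × B) : Strategy A B S C n :=
  fun t past sig => σ ⟨t + 1, Nat.succ_lt_succ t.2⟩ (Fin.cons (α := fun _ => A × B) c past)
    (Fin.cons (α := fun _ => S) s sig)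

/-- The strategy with given first action and given continuations. -/
def prepend (f : S → C) (k : S → A × B → Strategy A B S C n) : Strategy A B S C (n + 1) :=
  fun t => match t with
    | ⟨0, _⟩ => fun _ sig => f (sig 0)
    | ⟨t + 1, h⟩ => fun past sig => k (sig 0) (past 0) ⟨t, Nat.lt_of_succ_lt_succ h⟩
        (fun i => past i.succ) (fun i => sig i.succ)

@[simp] theorem first_prepend (f : S → C) (k : S → A × B → Strategy A B S C n) :
    (prepend f k).first = f := rfl

@[simp] theorem next_prepend (f : S → C) (k : S → A × B → Strategy A B S C n) :
    (prepend f k).next = k := rfl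

/-- The same strategy, with the two components of the action pairs exchanged. -/
def swap (σ : Strategy A B S C n) : Strategy B A S C n :=
  fun t past sig => σ t (fun i => (past i).swap) sig

theorem swap_swap (σ : Strategy A B S C n) : σ.swap.swap = σ := rfl

theorem first_swap (σ : Strategy A B S C (n + 1)) : σ.swap.first = σ.first := by
  funext s
  unfold first swap
  congr 1
  funext i
  exact i.elim0

theorem next_swap (σ : Strategy A B S C (n + 1)) (s : S) (c : B × A) :
    σ.swap.next s c = (σ.next s c.swap).swap := by
  funext t past sig
  unfold next swap
  congr 1
  funext i
  refine Fin.cases ?_ (fun j => ?_) i <;> simp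

end Strategy

/-- `play` recurses on the last stage, whereas every later induction conditions on the first one.
This identity converts between the two. -/
theorem play_succ {A B X Y : Type*} {n : ℕ} (σ : Strategy A B X A (n + 1)) (τ : Strategy A B Y B (n + 1))
    (z : X × Y) (ω : Fin n → X × Y) (t : ℕ) (h : t + 1 ≤ n + 1) :
    play σ τ (Fin.cons (α := fun _ => X × Y) z ω) (t + 1) h =
      Fin.cons (α := fun _ => A × B) (σ.first z.1, τ.first z.2)
        (play (σ.next z.1 (σ.first z.1, τ.first z.2)) (τ.next z.2 (σ.first z.1, τ.first z.2)) ω t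
          (Nat.le_of_succ_le_succ h)) := by
  induction t with
  | zero =>
    funext i
    obtain rfl : i = 0 := Fin.ext (by omega)
    simp only [play, Fin.cons_zero]
    refine Prod.ext ?_ ?_
    · change σ _ _ _ = _
      unfold Strategy.first
      congr 1
      funext j
      obtain rfl : j = 0 := Fin.ext (by omega)
      rfl
    · change τ _ _ _ = _
      unfold Strategy.first
      congr 1
      funext j
      obtain rfl : j = 0 := Fin.ext (by omega)
      rfl
  | succ t ih =>
    have key : ∀ i : Fin (t + 1 + 1),
        (Fin.cons (α := fun _ => X × Y) z ω : Fin (n + 1) → X × Y) (Fin.castLE h i) =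
          (Fin.cons (α := fun _ => X × Y) z fun j : Fin (t + 1) =>
            ω (Fin.castLE (Nat.le_of_succ_le_succ h) j) : Fin (t + 1 + 1) → X × Y) i := by
      intro i
      refine Fin.cases rfl (fun j => ?_) i
      rfl
    rw [play, ih]
    simp only [play]
    rw [Fin.cons_snoc_eq_snoc_cons]
    congr 1
    refine Prod.ext ?_ ?_
    · unfold Strategy.next
      simp only
      congr 1
      funext i
      rw [key]
      refine Fin.cases rfl (fun j => ?_) i
      rfl
    · unfold Strategy.next
      simp only
      congr 1
      funext i
      rw [key]
      refine Fin.cases rfl (fun j => ?_) i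
      rfl

/-! ### The payoff as a recursion on the number of stages -/

section Recursion

variable {A B X Y : Type*} [Fintype X] [Fintype Y]

/-- The expected total payoff, by recursion on the number of stages. -/
noncomputable def totalPayoff (u : A → B → ℝ) (p : X × Y → ℝ) :
    {n : ℕ} → Strategy A B X A n → Strategy A B Y B n → ℝ
  | 0, _, _ => 0
  | _ + 1, σ, τ => ∑ z, p z * (u (σ.first z.1) (τ.first z.2) +
      totalPayoff u p (σ.next z.1 (σ.first z.1, τ.first z.2))
        (τ.next z.2 (σ.first z.1, τ.first z.2)))

theorem sum_fin_succ {Z : Type*} [Fintype Z] {n : ℕ} (F : (Fin (n + 1) → Z) → ℝ) :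
    ∑ ω, F ω = ∑ z, ∑ ω : Fin n → Z, F (Fin.cons (α := fun _ => Z) z ω) := by
  rw [← Fintype.sum_prod_type']
  exact (Fintype.sum_equiv (Fin.consEquiv fun _ : Fin (n + 1) => Z) _ _ fun _ => rfl).symm

theorem sum_prod_pi {ι Z : Type*} [Fintype ι] [DecidableEq ι] [Fintype Z] (q : ι → Z → ℝ) :
    ∑ ω : ι → Z, ∏ i, q i (ω i) = ∏ i, ∑ z, q i z := by
  rw [Finset.prod_univ_sum, Fintype.piFinset_univ]

theorem expectedPayoff_eq (u : A → B → ℝ) {p : X × Y → ℝ} (hp : ∑ z, p z = 1) {n : ℕ}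
    (σ : Strategy A B X A n) (τ : Strategy A B Y B n) :
    expectedPayoff u p σ τ = (1 / (n : ℝ)) * totalPayoff u p σ τ := by
  have main : ∀ (n : ℕ) (σ : Strategy A B X A n) (τ : Strategy A B Y B n),
      ∑ ω : Fin n → X × Y, (∏ t, p (ω t)) *
        ∑ t : Fin n, u (play σ τ ω n le_rfl t).1 (play σ τ ω n le_rfl t).2 =
      totalPayoff u p σ τ := by
    intro n
    induction n with
    | zero => intro σ τ; simp [totalPayoff]
    | succ n ih =>
      intro σ τ
      rw [sum_fin_succ, totalPayoff]
      refine Finset.sum_congr rfl fun z _ => ?_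
      rw [← ih, mul_add, Finset.mul_sum]
      have h1 : p z * u (σ.first z.1) (τ.first z.2) =
          ∑ ω : Fin n → X × Y, p z * ((∏ t, p (ω t)) * u (σ.first z.1) (τ.first z.2)) := by
        rw [← Finset.mul_sum, ← Finset.sum_mul, sum_prod_pi fun _ : Fin n => p]
        simp [hp]
      rw [h1, ← Finset.sum_add_distrib]
      refine Finset.sum_congr rfl fun ω _ => ?_
      rw [Fin.prod_univ_succ, Fin.sum_univ_succ, play_succ]
      simp only [Fin.cons_zero, Fin.cons_succ]
      ring
  rw [← main, expectedPayoff, Finset.mul_sum]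
  exact Finset.sum_congr rfl fun ω _ => by ring

/-- The game is zero-sum, so exchanging the players and negating `u` is a symmetry; it transfers
each result about Alice to Bob. -/
theorem totalPayoff_swap (u : A → B → ℝ) (p : X × Y → ℝ) {n : ℕ}
    (σ : Strategy A B X A n) (τ : Strategy A B Y B n) :
    totalPayoff (fun b a => -u a b) (fun z : Y × X => p (z.2, z.1)) τ.swap σ.swap =
      -totalPayoff u p σ τ := by
  induction n with
  | zero => simp [totalPayoff]
  | succ n ih =>
    rw [totalPayoff, totalPayoff, ← Finset.sum_neg_distrib]
    refine Fintype.sum_equiv (Equiv.prodComm Y X) _ _ fun z => ?_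
    simp only [Strategy.first_swap, Strategy.next_swap, Equiv.prodComm_apply, Prod.swap_prod_mk,
      Prod.fst_swap, Prod.snd_swap, ih]
    change p (z.2, z.1) * _ = -(p (z.2, z.1) * _)
    ring

theorem abs_totalPayoff_le {u : A → B → ℝ} {p : X × Y → ℝ} (hp : p ∈ stdSimplex ℝ (X × Y))
    {M : ℝ} (hu : ∀ a b, |u a b| ≤ M) {n : ℕ}
    (σ : Strategy A B X A n) (τ : Strategy A B Y B n) : |totalPayoff u p σ τ| ≤ n * M := by
  induction n with
  | zero => simp [totalPayoff]
  | succ n ih =>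
    rw [totalPayoff]
    calc _ ≤ ∑ z, p z * (((n + 1 : ℕ) : ℝ) * M) := by
          refine (Finset.abs_sum_le_sum_abs _ _).trans (Finset.sum_le_sum fun z _ => ?_)
          rw [abs_mul, abs_of_nonneg (hp.1 z)]
          refine mul_le_mul_of_nonneg_left ?_ (hp.1 z)
          refine (abs_add_le _ _).trans ?_
          push_cast
          linarith [hu (σ.first z.1) (τ.first z.2), ih (σ.next z.1 (σ.first z.1, τ.first z.2))
            (τ.next z.2 (σ.first z.1, τ.first z.2))]
      _ = _ := by rw [← Finset.sum_mul, hp.2, one_mul]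

end Recursion

/-! ### Entropy of unnormalised weights -/

section Entropy

open Real

/-- The entropy function `x ↦ -x log x`, in bits. -/
noncomputable def negMulLogb (x : ℝ) : ℝ := -(x * logb 2 x)

theorem negMulLogb_zero : negMulLogb 0 = 0 := by simp [negMulLogb]

theorem negMulLogb_one : negMulLogb 1 = 0 := by simp [negMulLogb]

theorem negMulLogb_eq (x : ℝ) : negMulLogb x = negMulLog x / log 2 := by
  rw [negMulLogb, logb, negMulLog]; ring

theorem negMulLogb_mul (x y : ℝ) :
    negMulLogb (x * y) = y * negMulLogb x + x * negMulLogb y := by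
  simp only [negMulLogb_eq, negMulLog_mul]; ring

theorem negMulLogb_nonneg {x : ℝ} (h0 : 0 ≤ x) (h1 : x ≤ 1) : 0 ≤ negMulLogb x := by
  rw [negMulLogb_eq]
  exact div_nonneg (negMulLog_nonneg h0 h1) (log_nonneg (by norm_num))

/-- The entropy of a finite family of weights, scaled so as to be homogeneous of degree one:
`∑ -w log w + W log W` with `W = ∑ w`. -/
noncomputable def weightEntropy {Z : Type*} [Fintype Z] (w : Z → ℝ) : ℝ :=
  ∑ z, negMulLogb (w z) - negMulLogb (∑ z, w z)

variable {Z A X Y : Type*} [Fintype Z] [Fintype A] [Fintype X] [Fintype Y]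

theorem entropy_eq_sum (q : A → ℝ) : entropy q = ∑ a, negMulLogb (q a) := rfl

theorem weightEntropy_eq_entropy {q : A → ℝ} (hq : ∑ a, q a = 1) :
    weightEntropy q = entropy q := by
  rw [weightEntropy, hq, negMulLogb_one, sub_zero, entropy_eq_sum]

theorem entropy_nonneg {q : A → ℝ} (hq : q ∈ stdSimplex ℝ A) : 0 ≤ entropy q := by
  rw [entropy_eq_sum]
  refine Finset.sum_nonneg fun a _ => negMulLogb_nonneg (hq.1 a) ?_
  rw [← hq.2]
  exact Finset.single_le_sum (fun a _ => hq.1 a) (Finset.mem_univ a)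

theorem weightEntropy_smul (c : ℝ) (w : Z → ℝ) :
    weightEntropy (fun z => c * w z) = c * weightEntropy w := by
  simp only [weightEntropy, ← Finset.mul_sum, negMulLogb_mul, Finset.sum_add_distrib,
    ← Finset.sum_mul]
  ring

theorem normalize_mem_stdSimplex {w : Z → ℝ} (hw : ∀ z, 0 ≤ w z) (hW : 0 < ∑ z, w z) :
    (fun z => (∑ z, w z)⁻¹ * w z) ∈ stdSimplex ℝ Z :=
  ⟨fun z => mul_nonneg (inv_nonneg.2 hW.le) (hw z), by
    rw [← Finset.mul_sum]; exact inv_mul_cancel₀ hW.ne'⟩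

theorem weightEntropy_eq_mul_entropy {w : Z → ℝ} (hw : ∀ z, 0 ≤ w z) (hW : 0 < ∑ z, w z) :
    weightEntropy w = (∑ z, w z) * entropy (fun z => (∑ z, w z)⁻¹ * w z) := by
  rw [← weightEntropy_eq_entropy (normalize_mem_stdSimplex hw hW).2, weightEntropy_smul,
    mul_inv_cancel_left₀ hW.ne']

theorem weightEntropy_of_sum_eq_zero {w : Z → ℝ} (hw : ∀ z, 0 ≤ w z) (hW : ∑ z, w z = 0) :
    weightEntropy w = 0 := by
  have h : ∀ z, w z = 0 := fun z =>
    (Finset.sum_eq_zero_iff_of_nonneg fun z _ => hw z).1 hW z (Finset.mem_univ z)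
  simp [weightEntropy, h, negMulLogb_zero]

theorem weightEntropy_nonneg {w : Z → ℝ} (hw : ∀ z, 0 ≤ w z) : 0 ≤ weightEntropy w := by
  rcases (Finset.sum_nonneg fun z (_ : z ∈ Finset.univ) => hw z).eq_or_lt with h | h
  · rw [weightEntropy_of_sum_eq_zero hw h.symm]
  · rw [weightEntropy_eq_mul_entropy hw h]
    exact mul_nonneg h.le (entropy_nonneg (normalize_mem_stdSimplex hw h))

/-- Chain rule for a function of the hidden variable. -/
theorem weightEntropy_fiberwise [DecidableEq A] (w : Z → ℝ) (f : Z → A) :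
    weightEntropy w = weightEntropy (fun a => ∑ z, if f z = a then w z else 0) +
      ∑ a, weightEntropy (fun z => if f z = a then w z else 0) := by
  have h1 : ∀ v : Z → ℝ, ∑ a, ∑ z, (if f z = a then v z else 0) = ∑ z, v z := fun v => by
    rw [Finset.sum_comm]; simp
  simp only [weightEntropy, Finset.sum_sub_distrib, h1]
  have h2 : ∑ a, ∑ z, negMulLogb (if f z = a then w z else 0) = ∑ z, negMulLogb (w z) := by
    rw [← h1]
    refine Finset.sum_congr rfl fun a _ => Finset.sum_congr rfl fun z _ => ?_
    split_ifs
    · rfl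
    · exact negMulLogb_zero
  rw [h2]
  ring

theorem condEntropy_eq {p : X × Y → ℝ} (hp : ∀ z, 0 ≤ p z) :
    condEntropy p = ∑ y, weightEntropy fun x => p (x, y) := by
  rw [condEntropy, Finset.sum_comm]
  refine Finset.sum_congr rfl fun y _ => ?_
  have h : ∀ x, -(p (x, y) * logb 2 (p (x, y) / ∑ x', p (x', y))) =
      negMulLogb (p (x, y)) + p (x, y) * logb 2 (∑ x', p (x', y)) := by
    intro x
    rcases (hp (x, y)).eq_or_lt with h0 | h0
    · simp [negMulLogb, ← h0]
    · have : 0 < ∑ x', p (x', y) :=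
        h0.trans_le (Finset.single_le_sum (f := fun x' => p (x', y)) (fun x' _ => hp (x', y))
          (Finset.mem_univ x))
      rw [logb_div h0.ne' this.ne', negMulLogb]
      ring
  simp only [h, Finset.sum_add_distrib, weightEntropy, ← Finset.sum_mul]
  simp only [negMulLogb]
  ring

theorem condEntropy_nonneg {p : X × Y → ℝ} (hp : ∀ z, 0 ≤ p z) : 0 ≤ condEntropy p := by
  rw [condEntropy_eq hp]
  exact Finset.sum_nonneg fun y _ => weightEntropy_nonneg fun x => hp (x, y)

/-- Revealing `y` for a fresh, independent pair `(x, y)` adds `H(x | y)` to the hidden entropy. -/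
theorem sum_weightEntropy_prod (w : Z → ℝ) {p : X × Y → ℝ} (hp : p ∈ stdSimplex ℝ (X × Y)) :
    ∑ y, weightEntropy (fun s : Z × X => w s.1 * p (s.2, y)) =
      weightEntropy w + (∑ z, w z) * condEntropy p := by
  have h1 : ∀ y, weightEntropy (fun s : Z × X => w s.1 * p (s.2, y)) =
      (∑ x, p (x, y)) * weightEntropy w + (∑ z, w z) * weightEntropy fun x => p (x, y) := by
    intro y
    simp only [weightEntropy, Fintype.sum_prod_type, negMulLogb_mul, Finset.sum_add_distrib,
      ← Finset.mul_sum, ← Finset.sum_mul]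
    ring
  have h2 : ∑ y, ∑ x, p (x, y) = 1 := by
    rw [← hp.2, Fintype.sum_prod_type_right]
  rw [Finset.sum_congr rfl fun y _ => h1 y, Finset.sum_add_distrib, ← Finset.sum_mul, h2,
    ← Finset.mul_sum, condEntropy_eq hp.1, one_mul]

end Entropy

/-! ### Upper bound: an entropy budget for Alice -/

section Converse

universe v

variable {A B Y : Type*} {X : Type v} [Fintype A] [Fintype B] [Nonempty B]

/-- Both sides are homogeneous of degree one in `r`, so the bound for probability vectors extends to
weights. Events of probability zero then need no conditioning. -/
theorem exists_sum_le_of_securityA_le {u : A → B → ℝ} {c d : ℝ}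
    (hcd : ∀ q ∈ stdSimplex ℝ A, securityA u q ≤ d + c * entropy q) {r : A → ℝ}
    (hr : ∀ a, 0 ≤ r a) : ∃ b, ∑ a, r a * u a b ≤ (∑ a, r a) * d + c * weightEntropy r := by
  rcases (Finset.sum_nonneg fun a (_ : a ∈ Finset.univ) => hr a).eq_or_lt with h | h
  · have h0 : ∀ a, r a = 0 := fun a =>
      (Finset.sum_eq_zero_iff_of_nonneg fun a _ => hr a).1 h.symm a (Finset.mem_univ a)
    exact ⟨Classical.arbitrary B, by rw [weightEntropy_of_sum_eq_zero hr h.symm]; simp [h0]⟩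
  · obtain ⟨b, -, hb⟩ := Finset.exists_mem_eq_inf' (s := (Finset.univ : Finset B))
      Finset.univ_nonempty fun b => ∑ a, (∑ a, r a)⁻¹ * r a * u a b
    refine ⟨b, ?_⟩
    have h1 := hcd _ (normalize_mem_stdSimplex hr h)
    rw [securityA, hb] at h1
    rw [weightEntropy_eq_mul_entropy hr h]
    have h2 := mul_le_mul_of_nonneg_left h1 h.le
    simp only [mul_assoc] at h2
    rw [← Finset.mul_sum, mul_inv_cancel_left₀ h.ne'] at h2
    linarith

variable [Fintype X] [Fintype Y]

/-- Bob's best response, stage by stage, to a strategy of Alice that depends on a hidden variable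
`z`: she cannot obtain more than her entropy budget allows. -/
theorem exists_totalPayoff_le_hidden {u : A → B → ℝ} {p : X × Y → ℝ}
    (hp : p ∈ stdSimplex ℝ (X × Y)) {c d : ℝ} (hc : 0 ≤ c)
    (hcd : ∀ q ∈ stdSimplex ℝ A, securityA u q ≤ d + c * entropy q) (n : ℕ) :
    ∀ (Z : Type v) [Fintype Z] (w : Z → ℝ), (∀ z, 0 ≤ w z) → ∀ σ : Z → Strategy A B X A n,
      ∃ τ : Strategy A B Y B n, ∑ z, w z * totalPayoff u p (σ z) τ ≤
        n * (∑ z, w z) * d + c * (weightEntropy w + n * (∑ z, w z) * condEntropy p) := by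
  classical
  induction n with
  | zero =>
    intro Z _ w hw σ
    refine ⟨fun t => t.elim0, ?_⟩
    simpa [totalPayoff] using mul_nonneg hc (weightEntropy_nonneg hw)
  | succ n ih =>
    intro Z _ w hw σ
    have hv : ∀ y : Y, ∀ s : Z × X, 0 ≤ w s.1 * p (s.2, y) := fun y s =>
      mul_nonneg (hw _) (hp.1 _)
    have hv' : ∀ (y : Y) a, ∀ s : Z × X,
        0 ≤ if (σ s.1).first s.2 = a then w s.1 * p (s.2, y) else 0 := fun y a s => by
      split_ifs
      exacts [hv y s, le_rfl]
    choose b hb using fun y : Y => exists_sum_le_of_securityA_le hcd (r := fun a =>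
      ∑ s : Z × X, if (σ s.1).first s.2 = a then w s.1 * p (s.2, y) else 0)
      fun a => Finset.sum_nonneg fun s _ => hv' y a s
    -- After the stage the hidden variable is `(z, x)`, with its weights restricted to the event
    -- that Bob saw `y` and Alice played `a`.
    choose k hk using fun (y : Y) a => ih (Z × X) _ (hv' y a)
      fun s => (σ s.1).next s.2 (a, b y)
    refine ⟨Strategy.prepend b fun y c => k y c.1, ?_⟩
    have hsum : ∀ (y : Y) (v : Z × X → ℝ),
        ∑ a, ∑ s, (if (σ s.1).first s.2 = a then v s else 0) = ∑ s, v s := fun y v => by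
      rw [Finset.sum_comm]; simp
    have key : ∀ y, ∑ s : Z × X, w s.1 * p (s.2, y) * (u ((σ s.1).first s.2) (b y) +
          totalPayoff u p ((σ s.1).next s.2 ((σ s.1).first s.2, b y))
            (k y ((σ s.1).first s.2))) ≤
        (n + 1) * (∑ s : Z × X, w s.1 * p (s.2, y)) * d +
          c * (weightEntropy (fun s : Z × X => w s.1 * p (s.2, y)) +
            n * (∑ s : Z × X, w s.1 * p (s.2, y)) * condEntropy p) := by
      intro y
      -- The chain rule splits the budget: the entropy of the action pays for this stage's payoff,
      -- and the entropy left given the action is what the induction hypothesis consumes.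
      rw [weightEntropy_fiberwise _ fun s : Z × X => (σ s.1).first s.2]
      have h1 := hb y
      have h2 := Finset.sum_le_sum fun a (_ : a ∈ Finset.univ) => hk y a
      simp only [Finset.sum_add_distrib, ← Finset.mul_sum, ← Finset.sum_mul] at h2
      rw [hsum y] at h1 h2
      have h3 : ∑ s : Z × X, w s.1 * p (s.2, y) * u ((σ s.1).first s.2) (b y) =
          ∑ a, (∑ s : Z × X, if (σ s.1).first s.2 = a then w s.1 * p (s.2, y) else 0) *
            u a (b y) := by
        simp only [Finset.sum_mul]
        rw [Finset.sum_comm]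
        simp
      have h4 : ∑ s : Z × X, w s.1 * p (s.2, y) *
          totalPayoff u p ((σ s.1).next s.2 ((σ s.1).first s.2, b y))
            (k y ((σ s.1).first s.2)) =
          ∑ a, ∑ s : Z × X, (if (σ s.1).first s.2 = a then w s.1 * p (s.2, y) else 0) *
            totalPayoff u p ((σ s.1).next s.2 (a, b y)) (k y a) := by
        rw [Finset.sum_comm]
        simp
      simp only [mul_add, Finset.sum_add_distrib]
      rw [h3, h4]
      simp only [mul_add] at h1 h2 ⊢
      linarith
    have hW : ∑ y, ∑ s : Z × X, w s.1 * p (s.2, y) = ∑ z, w z := by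
      rw [Finset.sum_comm]
      simp only [Fintype.sum_prod_type, ← Finset.mul_sum]
      rw [← Fintype.sum_prod_type (f := p), hp.2]
      simp
    have hE := sum_weightEntropy_prod w hp
    have hfin := Finset.sum_le_sum fun y (_ : y ∈ Finset.univ) => key y
    simp only [Finset.sum_add_distrib, ← Finset.mul_sum, ← Finset.sum_mul] at hfin
    rw [hW, hE] at hfin
    refine le_of_eq_of_le ?_ (hfin.trans (le_of_eq ?_))
    · simp only [totalPayoff, Strategy.first_prepend, Strategy.next_prepend, Finset.mul_sum]
      rw [Finset.sum_comm (s := (Finset.univ : Finset Y)), Fintype.sum_prod_type]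
      refine Finset.sum_congr rfl fun z _ => ?_
      rw [Fintype.sum_prod_type]
      refine Finset.sum_congr rfl fun x _ => Finset.sum_congr rfl fun y _ => ?_
      ring
    · push_cast; ring

theorem exists_totalPayoff_le {u : A → B → ℝ} {p : X × Y → ℝ}
    (hp : p ∈ stdSimplex ℝ (X × Y)) {c d : ℝ} (hc : 0 ≤ c)
    (hcd : ∀ q ∈ stdSimplex ℝ A, securityA u q ≤ d + c * entropy q) {n : ℕ}
    (σ : Strategy A B X A n) :
    ∃ τ : Strategy A B Y B n, totalPayoff u p σ τ ≤ n * (d + c * condEntropy p) := by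
  -- Initially nothing is hidden: a one-point variable of weight one has entropy zero.
  obtain ⟨τ, hτ⟩ := exists_totalPayoff_le_hidden hp hc hcd n PUnit.{v + 1} (fun _ => 1)
    (fun _ => zero_le_one) fun _ => σ
  refine ⟨τ, ?_⟩
  simp [weightEntropy, negMulLogb_one] at hτ
  linarith

end Converse

/-! ### Security levels -/

section Security

variable {A B : Type*} [Fintype A] [Fintype B] [Nonempty B]

theorem securityA_le (u : A → B → ℝ) (q : A → ℝ) (b : B) : securityA u q ≤ ∑ a, q a * u a b :=
  Finset.inf'_le _ (Finset.mem_univ b)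

theorem le_securityA {u : A → B → ℝ} {q : A → ℝ} {v : ℝ} (h : ∀ b, v ≤ ∑ a, q a * u a b) :
    v ≤ securityA u q :=
  Finset.le_inf' _ _ fun b _ => h b

variable {u : A → B → ℝ} {M : ℝ}

theorem abs_sum_mul_le_of_mem_stdSimplex {A B : Type*} [Fintype A] {u : A → B → ℝ} {M : ℝ} (hu : ∀ a b, |u a b| ≤ M) {q : A → ℝ}
    (hq : q ∈ stdSimplex ℝ A) (b : B) : |∑ a, q a * u a b| ≤ M := by
  calc _ ≤ ∑ a, q a * M := by
        refine (Finset.abs_sum_le_sum_abs _ _).trans (Finset.sum_le_sum fun a _ => ?_)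
        rw [abs_mul, abs_of_nonneg (hq.1 a)]
        exact mul_le_mul_of_nonneg_left (hu a b) (hq.1 a)
    _ = M := by rw [← Finset.sum_mul, hq.2, one_mul]

theorem securityA_le_bound (hu : ∀ a b, |u a b| ≤ M) {q : A → ℝ} (hq : q ∈ stdSimplex ℝ A) :
    securityA u q ≤ M :=
  (securityA_le u q (Classical.arbitrary B)).trans
    (le_of_abs_le (abs_sum_mul_le_of_mem_stdSimplex hu hq _))

theorem neg_bound_le_securityA (hu : ∀ a b, |u a b| ≤ M) {q : A → ℝ}
    (hq : q ∈ stdSimplex ℝ A) : -M ≤ securityA u q :=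
  le_securityA fun b => neg_le_of_abs_le (abs_sum_mul_le_of_mem_stdSimplex hu hq b)

theorem entropy_single [DecidableEq A] (a : A) : entropy (Pi.single a (1 : ℝ)) = 0 := by
  rw [entropy_eq_sum]
  refine Finset.sum_eq_zero fun i _ => ?_
  rcases eq_or_ne i a with rfl | h
  · rw [Pi.single_eq_same, negMulLogb_one]
  · rw [Pi.single_eq_of_ne h, negMulLogb_zero]

theorem le_valueA (hu : ∀ a b, |u a b| ≤ M) {q : A → ℝ} (hq : q ∈ stdSimplex ℝ A) {h : ℝ}
    (hh : entropy q ≤ h) : securityA u q ≤ valueA u h :=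
  le_csSup ⟨M, by rintro _ ⟨q, hq, rfl⟩; exact securityA_le_bound hu hq.1⟩ ⟨q, ⟨hq, hh⟩, rfl⟩

theorem exists_lt_securityA [Nonempty A] {h v : ℝ} (hh : 0 ≤ h) (hv : v < valueA u h) :
    ∃ q ∈ stdSimplex ℝ A, entropy q ≤ h ∧ v < securityA u q := by
  classical
  obtain ⟨_, ⟨q, hq, rfl⟩, hlt⟩ := exists_lt_of_lt_csSup
    (⟨_, Pi.single (Classical.arbitrary A) 1, ⟨single_mem_stdSimplex ℝ _, by
      simpa [entropy_single] using hh⟩, rfl⟩ :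
      (securityA u '' {q | q ∈ stdSimplex ℝ A ∧ entropy q ≤ h}).Nonempty) hv
  exact ⟨q, hq.1, hq.2, hlt⟩

theorem valueA_le [Nonempty A] (hu : ∀ a b, |u a b| ≤ M) {h : ℝ} (hh : 0 ≤ h) :
    valueA u h ≤ M := by
  by_contra! hlt
  obtain ⟨q, hq, -, h2⟩ := exists_lt_securityA hh hlt
  exact absurd (securityA_le_bound hu hq) (not_le.2 h2)

theorem neg_bound_le_valueA [Nonempty A] (hu : ∀ a b, |u a b| ≤ M) {h : ℝ} (hh : 0 ≤ h) :
    -M ≤ valueA u h := by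
  classical
  have hs := single_mem_stdSimplex ℝ (Classical.arbitrary A)
  exact (neg_bound_le_securityA hu hs).trans (le_valueA hu hs ((entropy_single _).trans_le hh))

/-- Take the most likely action. Min-entropy is at most Shannon entropy, and `1 - x ≤ -log x ≤ -logb
2 x` on `(0, 1]` because `log 2 ≤ 1`. -/
theorem exists_one_sub_le_entropy [Nonempty A] {q : A → ℝ} (hq : q ∈ stdSimplex ℝ A) :
    ∃ a, 1 - q a ≤ entropy q := by
  obtain ⟨a, -, ha⟩ := Finset.exists_max_image Finset.univ q Finset.univ_nonempty
  refine ⟨a, ?_⟩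
  have hpos : 0 < q a := by
    by_contra! h0
    have : ∑ a, q a ≤ 0 := Finset.sum_nonpos fun i _ => (ha i (Finset.mem_univ i)).trans h0
    rw [hq.2] at this
    linarith
  have hle : q a ≤ 1 := by
    rw [← hq.2]
    exact Finset.single_le_sum (fun a _ => hq.1 a) (Finset.mem_univ a)
  have h1 : -Real.logb 2 (q a) ≤ entropy q := by
    calc -Real.logb 2 (q a) = ∑ i, q i * -Real.logb 2 (q a) := by
          rw [← Finset.sum_mul, hq.2, one_mul]
      _ ≤ entropy q := by
          refine Finset.sum_le_sum fun i _ => ?_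
          rw [← mul_neg]
          rcases (hq.1 i).eq_or_lt with h0 | h0
          · simp [← h0]
          · refine mul_le_mul_of_nonneg_left (neg_le_neg ?_) h0.le
            exact Real.logb_le_logb_of_le (by norm_num) h0 (ha i (Finset.mem_univ i))
  refine le_trans ?_ h1
  rw [Real.logb, ← neg_div, le_div_iff₀ (Real.log_pos (by norm_num))]
  have h2 := Real.log_le_sub_one_of_pos hpos
  have h3 : Real.log 2 ≤ 1 := by linarith [Real.log_two_lt_d9]
  nlinarith

/-- `securityA` exceeds its maximum over pure actions by at most a multiple of the entropy. -/
theorem securityA_le_valueA_zero_add [Nonempty A] (hu : ∀ a b, |u a b| ≤ M) {q : A → ℝ}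
    (hq : q ∈ stdSimplex ℝ A) : securityA u q ≤ valueA u 0 + 2 * M * entropy q := by
  classical
  obtain ⟨a₀, ha₀⟩ := exists_one_sub_le_entropy hq
  have hM : 0 ≤ M := (abs_nonneg _).trans (hu a₀ (Classical.arbitrary B))
  have h1 := le_valueA hu (single_mem_stdSimplex ℝ a₀) (entropy_single a₀).le
  have h2 : securityA u q - 2 * M * (1 - q a₀) ≤ securityA u (Pi.single a₀ 1) := by
    refine le_securityA fun b => ?_
    have h3 : ∑ a, (Pi.single a₀ (1 : ℝ) : A → ℝ) a * u a b = u a₀ b := by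
      simp [Pi.single_apply]
    rw [h3]
    have h4 : ∑ a, q a * (u a b - u a₀ b) ≤ ∑ a, if a = a₀ then 0 else q a * (2 * M) := by
      refine Finset.sum_le_sum fun a _ => ?_
      split_ifs with h
      · simp [h]
      · refine mul_le_mul_of_nonneg_left ?_ (hq.1 a)
        linarith [le_of_abs_le (hu a b), neg_le_of_abs_le (hu a₀ b)]
    have h5 : ∑ a, (if a = a₀ then 0 else q a * (2 * M)) = 2 * M * (1 - q a₀) := by
      rw [← hq.2]
      have : ∀ a, (if a = a₀ then 0 else q a * (2 * M)) =
          q a * (2 * M) - if a = a₀ then q a * (2 * M) else 0 := fun a => by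
        split_ifs <;> ring
      simp only [this, Finset.sum_sub_distrib, ← Finset.sum_mul, Finset.sum_ite_eq',
        Finset.mem_univ, if_true]
      ring
    have h6 : ∑ a, q a * (u a b - u a₀ b) = ∑ a, q a * u a b - u a₀ b := by
      simp only [mul_sub, Finset.sum_sub_distrib, ← Finset.sum_mul, hq.2, one_mul]
    linarith [securityA_le u q b]
  nlinarith

end Security

/-! ### Envelopes and supporting lines -/

section Envelope

theorem upperConcaveEnvelope_le {f g : ℝ → ℝ} {m h : ℝ} (hm : ∀ x, 0 ≤ x → m ≤ f x)
    (hg : ConcaveOn ℝ (Set.Ici 0) g) (hfg : ∀ x, 0 ≤ x → f x ≤ g x) (hh : 0 ≤ h) :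
    upperConcaveEnvelope f h ≤ g h := by
  rw [upperConcaveEnvelope]
  apply csInf_le
  · refine ⟨m, ?_⟩
    rintro _ ⟨g, -, hfg, rfl⟩
    exact (hm h hh).trans (hfg h hh)
  · exact ⟨g, hg, hfg, rfl⟩

theorem exists_concaveOn_lt {f : ℝ → ℝ} {m h y : ℝ} (hm : ∀ x, 0 ≤ x → f x ≤ m)
    (hy : upperConcaveEnvelope f h < y) :
    ∃ g : ℝ → ℝ, ConcaveOn ℝ (Set.Ici 0) g ∧ (∀ x, 0 ≤ x → f x ≤ g x) ∧ g h < y := by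
  rw [upperConcaveEnvelope] at hy
  obtain ⟨_, ⟨g, hg, hfg, rfl⟩, hlt⟩ := exists_lt_of_csInf_lt
    (by exact ⟨m, fun _ => m, concaveOn_const m (convex_Ici 0), hm, rfl⟩) hy
  exact ⟨g, hg, hfg, hlt⟩

theorem le_upperConcaveEnvelope {f : ℝ → ℝ} {m h : ℝ} (hm : ∀ x, 0 ≤ x → f x ≤ m)
    (hh : 0 ≤ h) : f h ≤ upperConcaveEnvelope f h := by
  by_contra! hlt
  obtain ⟨g, -, hfg, hlt⟩ := exists_concaveOn_lt hm hlt
  exact absurd (hfg h hh) (not_le.2 hlt)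

theorem lowerConvexEnvelope_eq (f : ℝ → ℝ) (h : ℝ) :
    lowerConvexEnvelope f h = -upperConcaveEnvelope (fun x => -f x) h := by
  rw [lowerConvexEnvelope, upperConcaveEnvelope, ← Real.sSup_neg]
  congr 1
  ext y
  constructor
  · rintro ⟨g, hg, hgf, rfl⟩
    exact ⟨-g, hg.neg, fun x hx => neg_le_neg (hgf x hx), rfl⟩
  · rintro ⟨g, hg, hgf, hy⟩
    exact ⟨-g, hg.neg, fun x hx => neg_le.1 (hgf x hx), by simp [← hy]⟩

theorem valueB_eq {A B : Type*} [Fintype A] [Fintype B] [Nonempty A] (u : A → B → ℝ) :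
    valueB u = fun h => -valueA (fun b a => -u a b) h := by
  funext h
  have hs : ∀ q : B → ℝ, securityB u q = -securityA (fun b a => -u a b) q := fun q => by
    rw [securityA, securityB]
    simp only [mul_neg, Finset.sum_neg_distrib]
    refine le_antisymm (Finset.sup'_le _ _ fun a ha => ?_) ?_
    · rw [le_neg]
      exact Finset.inf'_le (fun a => -∑ b, q b * u a b) ha
    · rw [neg_le]
      exact Finset.le_inf' _ _ fun a ha => neg_le_neg (Finset.le_sup' (fun a => ∑ b, q b * u a b) ha)
  rw [valueB, valueA, ← Real.sInf_neg, ← Set.image_neg_eq_neg, Set.image_image]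
  simp only [← hs]

/-- A concave function on `[0, ∞)` that is bounded below has a nondecreasing supporting line at
every interior point. -/
theorem _root_.ConcaveOn.exists_affine_ge {g : ℝ → ℝ} (hg : ConcaveOn ℝ (Set.Ici 0) g) {m h : ℝ}
    (hm : ∀ x, 0 ≤ x → m ≤ g x) (hh : 0 < h) :
    ∃ c, 0 ≤ c ∧ ∀ x, 0 ≤ x → g x ≤ g h + c * (x - h) := by
  have hslope : ∀ x y, 0 ≤ x → x < h → h < y → (g y - g h) / (y - h) ≤ (g h - g x) / (h - x) :=
    fun x y hx hxh hy => hg.slope_anti_adjacent hx (hh.trans hy).le hxh hy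
  -- The slope is the supremum of the chord slopes to the right of `h`; chords to the left bound it
  -- above.
  set S := (fun y => (g y - g h) / (y - h)) '' Set.Ioi h
  have hne : S.Nonempty := ⟨_, h + 1, by simp, rfl⟩
  have hbdd : BddAbove S := ⟨(g h - g 0) / (h - 0), by
    rintro _ ⟨y, hy, rfl⟩; exact hslope 0 y le_rfl hh hy⟩
  have haff : ∀ x, 0 ≤ x → g x ≤ g h + sSup S * (x - h) := by
    intro x hx
    rcases lt_trichotomy x h with hxh | rfl | hxh
    · have : sSup S ≤ (g h - g x) / (h - x) := csSup_le hne (by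
        rintro _ ⟨y, hy, rfl⟩; exact hslope x y hx hxh hy)
      rw [le_div_iff₀ (by linarith)] at this
      linarith
    · simp
    · have : (g x - g h) / (x - h) ≤ sSup S := le_csSup hbdd ⟨x, hxh, rfl⟩
      rw [div_le_iff₀ (by linarith)] at this
      linarith
  refine ⟨sSup S, ?_, haff⟩
  by_contra! hneg
  -- At this point a line of negative slope has dropped to `m - 1`, below the lower bound of `g`.
  have hx : 0 ≤ h + (g h - m + 1) / -sSup S := by
    have := div_nonneg (show 0 ≤ g h - m + 1 by linarith [hm h hh.le]) (neg_pos.2 hneg).le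
    linarith
  have h1 := haff _ hx
  have h2 := hm _ hx
  rw [add_sub_cancel_left, div_neg, mul_neg, mul_div_cancel₀ _ hneg.ne] at h1
  linarith

variable {A B : Type*} [Fintype A] [Fintype B] [Nonempty A] [Nonempty B] {u : A → B → ℝ} {M : ℝ}

/-- At `h = 0` a concave function may have infinite slope, so the supporting line comes instead from
the linear bound `securityA_le_valueA_zero_add`. -/
theorem exists_affine_ge_securityA (hu : ∀ a b, |u a b| ≤ M) {h y : ℝ} (hh : 0 ≤ h)
    (hy : upperConcaveEnvelope (valueA u) h < y) :
    ∃ c d, 0 ≤ c ∧ (∀ q ∈ stdSimplex ℝ A, securityA u q ≤ d + c * entropy q) ∧ d + c * h < y := by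
  rcases hh.eq_or_lt with rfl | hpos
  · have hM : 0 ≤ M :=
      (abs_nonneg _).trans (hu (Classical.arbitrary A) (Classical.arbitrary B))
    refine ⟨2 * M, valueA u 0, by positivity, fun q hq => securityA_le_valueA_zero_add hu hq, ?_⟩
    rw [mul_zero, add_zero]
    exact (le_upperConcaveEnvelope (fun x hx => valueA_le hu hx) le_rfl).trans_lt hy
  · obtain ⟨g, hg, hfg, hlt⟩ := exists_concaveOn_lt (fun x hx => valueA_le hu hx) hy
    obtain ⟨c, hc, hle⟩ := hg.exists_affine_ge
      (fun x hx => (neg_bound_le_valueA hu hx).trans (hfg x hx)) hpos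
    refine ⟨c, g h - c * h, hc, fun q hq => ?_, by linarith⟩
    have hq0 := entropy_nonneg hq
    linarith [le_valueA hu hq le_rfl, hfg _ hq0, hle _ hq0]

end Envelope

/-! ### Time sharing between mixed actions -/

section Sustainable

variable {A B : Type*} [Fintype A] [Fintype B] [Nonempty B]

/-- There is a sequence of mixed actions of Alice with average entropy `h` and average security
level `v`, up to a bounded error in the sums. -/
def Sustainable (u : A → B → ℝ) (h v : ℝ) : Prop :=
  ∃ q : ℕ → A → ℝ, (∀ i, q i ∈ stdSimplex ℝ A) ∧ ∃ C : ℝ, ∀ N : ℕ,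
    ∑ i ∈ Finset.range N, entropy (q i) ≤ N * h + C ∧
      N * v - C ≤ ∑ i ∈ Finset.range N, securityA u (q i)

theorem sustainable_of_mem {u : A → B → ℝ} {q : A → ℝ} (hq : q ∈ stdSimplex ℝ A) {h v : ℝ}
    (hh : entropy q ≤ h) (hv : v ≤ securityA u q) : Sustainable u h v := by
  refine ⟨fun _ => q, fun _ => hq, 0, fun N => ?_⟩
  simp only [Finset.sum_const, Finset.card_range, nsmul_eq_mul, add_zero, sub_zero]
  exact ⟨by gcongr, by gcongr⟩

theorem Sustainable.mono {u : A → B → ℝ} {h v w : ℝ} (hs : Sustainable u h v) (hw : w ≤ v) :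
    Sustainable u h w := by
  obtain ⟨q, hq, C, hC⟩ := hs
  refine ⟨q, hq, C, fun N => ⟨(hC N).1, le_trans ?_ (hC N).2⟩⟩
  gcongr

theorem Sustainable.le_bound {u : A → B → ℝ} {M h v : ℝ} (hu : ∀ a b, |u a b| ≤ M)
    (hs : Sustainable u h v) : v ≤ M := by
  obtain ⟨q, hq, C, hC⟩ := hs
  by_contra! hlt
  obtain ⟨N, hN⟩ := exists_nat_gt (C / (v - M))
  rw [div_lt_iff₀ (by linarith)] at hN
  have h1 : ∑ i ∈ Finset.range N, securityA u (q i) ≤ N * M := by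
    simpa using Finset.sum_le_sum fun i (_ : i ∈ Finset.range N) => securityA_le_bound hu (hq i)
  linarith [(hC N).2]

/-- The counter `k` records how often `q₁` has been used, so each of the two sequences is consumed
in order and without gaps. -/
theorem sum_interleave {α : Type*} (k : ℕ → ℕ) (hk0 : k 0 = 0) (hk : ∀ N, k N ≤ N)
    (hk1 : ∀ N, k (N + 1) = k N + 1 ∨ k (N + 1) = k N) (q₁ q₂ : ℕ → α) (F : α → ℝ) (N : ℕ) :
    ∑ i ∈ Finset.range N, F (if k (i + 1) = k i + 1 then q₁ (k i) else q₂ (i - k i)) =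
      ∑ i ∈ Finset.range (k N), F (q₁ i) + ∑ i ∈ Finset.range (N - k N), F (q₂ i) := by
  induction N with
  | zero => simp [hk0]
  | succ N ih =>
    rw [Finset.sum_range_succ, ih]
    rcases hk1 N with h | h
    · rw [if_pos h, h, Finset.sum_range_succ, Nat.add_sub_add_right]
      ring
    · rw [if_neg (by omega), h, Nat.succ_sub (hk N), Finset.sum_range_succ]
      ring

/-- Interleave the two sequences, giving the first `⌊s * N⌋₊` of the first `N` places. The rounding
error stays below one, so the sums change by a bounded amount. -/
theorem Sustainable.convex {u : A → B → ℝ} {h₁ v₁ h₂ v₂ s t : ℝ} (H₁ : Sustainable u h₁ v₁)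
    (H₂ : Sustainable u h₂ v₂) (hs : 0 ≤ s) (ht : 0 ≤ t) (hst : s + t = 1) :
    Sustainable u (s * h₁ + t * h₂) (s * v₁ + t * v₂) := by
  obtain ⟨q₁, hq₁, C₁, hC₁⟩ := H₁
  obtain ⟨q₂, hq₂, C₂, hC₂⟩ := H₂
  set k : ℕ → ℕ := fun N => ⌊s * N⌋₊ with hkdef
  have hfl : ∀ N : ℕ, (k N : ℝ) ≤ s * N := fun N => Nat.floor_le (by positivity)
  have hfl' : ∀ N : ℕ, s * N < k N + 1 := fun N => Nat.lt_floor_add_one _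
  have hk : ∀ N, k N ≤ N := fun N => by
    have h1 := hfl N
    have h2 : s * N ≤ 1 * N := by gcongr; linarith
    exact_mod_cast h1.trans (h2.trans_eq (one_mul _))
  have hk1 : ∀ N, k (N + 1) = k N + 1 ∨ k (N + 1) = k N := fun N => by
    have h1 : k N ≤ k (N + 1) := Nat.floor_mono (by gcongr; simp)
    have h2 : (k (N + 1) : ℝ) < k N + 2 := by
      have := hfl (N + 1)
      push_cast at this
      linarith [hfl' N]
    have h3 : k (N + 1) < k N + 2 := by exact_mod_cast h2
    omega
  refine ⟨fun i => if k (i + 1) = k i + 1 then q₁ (k i) else q₂ (i - k i), fun i => ?_,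
    C₁ + C₂ + |h₁ - h₂| + |v₁ - v₂|, fun N => ?_⟩
  · dsimp only
    split_ifs
    exacts [hq₁ _, hq₂ _]
  · rw [sum_interleave k (by simp [hkdef]) hk hk1, sum_interleave k (by simp [hkdef]) hk hk1]
    have hcast : ((N - k N : ℕ) : ℝ) = N - k N := Nat.cast_sub (hk N)
    have hd : ∀ x y : ℝ, |(k N * x + (N - k N) * y) - N * (s * x + t * y)| ≤ |x - y| := by
      intro x y
      have : (k N * x + (N - k N) * y) - N * (s * x + t * y) = (k N - s * N) * (x - y) := by
        obtain rfl : t = 1 - s := by linarith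
        ring
      rw [this, abs_mul]
      refine mul_le_of_le_one_left (abs_nonneg _) (abs_le.2 ⟨?_, ?_⟩) <;>
        linarith [hfl N, hfl' N]
    have e1 := hC₁ (k N)
    have e2 := hC₂ (N - k N)
    rw [hcast] at e2
    have d1 := le_of_abs_le (hd h₁ h₂)
    have d2 := neg_le_of_abs_le (hd v₁ v₂)
    constructor
    · linarith [abs_nonneg (v₁ - v₂)]
    · linarith [abs_nonneg (h₁ - h₂)]

variable [Nonempty A] {u : A → B → ℝ} {M : ℝ}

theorem sustainable_neg_bound (hu : ∀ a b, |u a b| ≤ M) {h : ℝ} (hh : 0 ≤ h) :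
    Sustainable u h (-M) := by
  classical
  have hs := single_mem_stdSimplex ℝ (Classical.arbitrary A)
  exact sustainable_of_mem hs ((entropy_single _).trans_le hh) (neg_bound_le_securityA hu hs)

/-- The supremum `G` of sustainable levels is concave by time sharing and dominates `valueA u`,
hence dominates its concave envelope. -/
theorem sustainable_of_lt_envelope (hu : ∀ a b, |u a b| ≤ M) {h v : ℝ} (hh : 0 ≤ h)
    (hv : v < upperConcaveEnvelope (valueA u) h) : Sustainable u h v := by
  set G : ℝ → ℝ := fun x => sSup {w | Sustainable u x w}
  have hne : ∀ x, 0 ≤ x → {w | Sustainable u x w}.Nonempty := fun x hx =>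
    ⟨-M, sustainable_neg_bound hu hx⟩
  have hbdd : ∀ x, BddAbove {w | Sustainable u x w} := fun x => ⟨M, fun w hw => hw.le_bound hu⟩
  have hG : ConcaveOn ℝ (Set.Ici 0) G := by
    refine ⟨convex_Ici 0, fun x hx y hy s t hs ht hst => ?_⟩
    refine le_of_forall_pos_le_add fun ε hε => ?_
    obtain ⟨v₁, hv₁, hlt₁⟩ := exists_lt_of_lt_csSup (hne x hx) (sub_lt_self (G x) hε)
    obtain ⟨v₂, hv₂, hlt₂⟩ := exists_lt_of_lt_csSup (hne y hy) (sub_lt_self (G y) hε)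
    have h1 : s * v₁ + t * v₂ ≤ G (s • x + t • y) :=
      le_csSup (hbdd _) (hv₁.convex hv₂ hs ht hst)
    have h2 : s * (G x - ε) ≤ s * v₁ := mul_le_mul_of_nonneg_left hlt₁.le hs
    have h3 : t * (G y - ε) ≤ t * v₂ := mul_le_mul_of_nonneg_left hlt₂.le ht
    have h4 : s * ε + t * ε = ε := by rw [← add_mul, hst, one_mul]
    simp only [smul_eq_mul] at h1 ⊢
    linarith
  have hle : ∀ x, 0 ≤ x → valueA u x ≤ G x := fun x hx => by
    refine le_of_forall_lt fun w hw => ?_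
    obtain ⟨q, hq, hqx, hlt⟩ := exists_lt_securityA hx hw
    exact hlt.trans_le (le_csSup (hbdd x) (sustainable_of_mem hq hqx le_rfl))
  obtain ⟨w, hw, hvw⟩ := exists_lt_of_lt_csSup (hne h hh) (hv.trans_le
    (upperConcaveEnvelope_le (fun x hx => neg_bound_le_valueA hu hx) hG hle hh))
  exact hw.mono hvw.le

/-- Mixing in a small fraction of pure actions lowers the entropy rate strictly, and the gap between
`v` and the envelope absorbs the loss. Block coding needs this slack. -/
theorem exists_sustainable_of_lt_envelope (hu : ∀ a b, |u a b| ≤ M) {h v : ℝ} (hh : 0 < h)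
    (hv : v < upperConcaveEnvelope (valueA u) h) : ∃ h' < h, Sustainable u h' v := by
  obtain ⟨w, hvw, hw⟩ := exists_between hv
  have hs := sustainable_of_lt_envelope hu hh.le hw
  have h0 : Sustainable u 0 (-M) := sustainable_neg_bound hu le_rfl
  -- With fraction `(w - v) / D` of pure actions the loss is `(w - v) / D * (w + M)`, which is at
  -- most `w - v`.
  set D := |w| + |M| + (w - v) + 1 with hD
  have hDpos : 0 < D := by linarith [abs_nonneg w, abs_nonneg M]
  refine ⟨(1 - (w - v) / D) * h + (w - v) / D * 0, ?_, ?_⟩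
  · have : 0 < (w - v) / D * h := mul_pos (div_pos (by linarith) hDpos) hh
    linarith
  · have ht1 : (w - v) / D ≤ 1 := by
      rw [div_le_one hDpos]
      linarith [abs_nonneg w, abs_nonneg M]
    have ht0 : 0 ≤ (w - v) / D := div_nonneg (by linarith) hDpos.le
    refine (hs.convex h0 (sub_nonneg.2 ht1) ht0 (by ring)).mono ?_
    have h1 : (w - v) / D * (w + M) ≤ (w - v) / D * D := by
      refine mul_le_mul_of_nonneg_left ?_ ht0
      linarith [le_abs_self w, le_abs_self M]
    rw [div_mul_cancel₀ _ hDpos.ne'] at h1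
    linarith

end Sustainable

/-! ### Second moments on finite products -/

section ProductWeights

variable {ι S : Type*} [Fintype ι] [DecidableEq ι] [Fintype S]

theorem sum_prod_mul_apply {π : ι → S → ℝ} (hπ : ∀ i, ∑ s, π i s = 1) (i : ι) (g : S → ℝ) :
    ∑ ω : ι → S, (∏ k, π k (ω k)) * g (ω i) = ∑ s, π i s * g s := by
  have h1 : ∀ ω : ι → S, (∏ k, π k (ω k)) * g (ω i) =
      ∏ k, π k (ω k) * if k = i then g (ω k) else 1 := fun ω => by
    rw [Finset.prod_mul_distrib, Finset.prod_ite_eq' Finset.univ i, if_pos (Finset.mem_univ i)]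
  simp only [h1]
  rw [sum_prod_pi fun k s => π k s * if k = i then g s else 1,
    Finset.prod_eq_single i (fun k _ hk => by simp [hk, hπ]) (by simp)]
  simp

theorem sum_prod_mul_sum_sq {π : ι → S → ℝ} (hπ : ∀ i, ∑ s, π i s = 1) {ζ : ι → S → ℝ}
    (hζ : ∀ i, ∑ s, π i s * ζ i s = 0) :
    ∑ ω : ι → S, (∏ k, π k (ω k)) * (∑ i, ζ i (ω i)) ^ 2 = ∑ i, ∑ s, π i s * ζ i s ^ 2 := by
  simp only [sq (∑ i, _), Finset.sum_mul_sum]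
  simp only [Finset.mul_sum]
  rw [Finset.sum_comm]
  refine Finset.sum_congr rfl fun i _ => ?_
  rw [Finset.sum_comm, Finset.sum_eq_single i]
  · simpa [sq] using sum_prod_mul_apply hπ i fun s => ζ i s * ζ i s
  · intro j _ hj
    have h1 : ∀ ω : ι → S, (∏ k, π k (ω k)) * (ζ i (ω i) * ζ j (ω j)) =
        ∏ k, π k (ω k) * ((if k = i then ζ k (ω k) else 1) * if k = j then ζ k (ω k) else 1) :=
      fun ω => by
        rw [Finset.prod_mul_distrib, Finset.prod_mul_distrib, Finset.prod_ite_eq' Finset.univ i,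
          Finset.prod_ite_eq' Finset.univ j, if_pos (Finset.mem_univ i),
          if_pos (Finset.mem_univ j)]
    simp only [h1]
    rw [sum_prod_pi fun k s =>
      π k s * ((if k = i then ζ k s else 1) * if k = j then ζ k s else 1)]
    exact Finset.prod_eq_zero (Finset.mem_univ i) (by simp [hj.symm, hζ])
  · simp

/-- Chebyshev's inequality for a sum of independent variables on a finite product. -/
theorem sum_prod_ite_le {π : ι → S → ℝ} (hπ : ∀ i, π i ∈ stdSimplex ℝ S) {ξ : ι → S → ℝ}
    {κ V : ℝ} (hκ : 0 < κ) (hV : ∀ i, ∑ s, π i s * ξ i s ^ 2 ≤ V) :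
    (∑ ω : ι → S, if (∑ i, ∑ s, π i s * ξ i s) + κ ≤ ∑ i, ξ i (ω i)
      then ∏ i, π i (ω i) else 0) ≤ Fintype.card ι * V / κ ^ 2 := by
  set μ : ι → ℝ := fun i => ∑ s, π i s * ξ i s with hμ
  have hζ : ∀ i, ∑ s, π i s * (ξ i s - μ i) = 0 := fun i => by
    simp only [mul_sub, Finset.sum_sub_distrib, ← Finset.sum_mul, (hπ i).2, one_mul]
    exact sub_self _
  have hvar : ∀ i, ∑ s, π i s * (ξ i s - μ i) ^ 2 ≤ V := fun i => by
    have : ∑ s, π i s * (ξ i s - μ i) ^ 2 =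
        ∑ s, π i s * ξ i s ^ 2 - 2 * μ i * ∑ s, π i s * ξ i s + μ i ^ 2 * ∑ s, π i s := by
      generalize μ i = c
      rw [Finset.mul_sum, Finset.mul_sum, ← Finset.sum_sub_distrib, ← Finset.sum_add_distrib]
      exact Finset.sum_congr rfl fun s _ => by ring
    rw [this, (hπ i).2]
    have h2 : ∑ s, π i s * ξ i s = μ i := rfl
    rw [h2]
    nlinarith [hV i, sq_nonneg (μ i)]
  have hnn : ∀ ω : ι → S, 0 ≤ ∏ i, π i (ω i) := fun ω =>
    Finset.prod_nonneg fun i _ => (hπ i).1 _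
  rw [le_div_iff₀ (by positivity)]
  calc _ ≤ ∑ ω : ι → S, (∏ k, π k (ω k)) * (∑ i, (ξ i (ω i) - μ i)) ^ 2 := by
        rw [Finset.sum_mul]
        refine Finset.sum_le_sum fun ω _ => ?_
        split_ifs with h
        · refine mul_le_mul_of_nonneg_left ?_ (hnn ω)
          rw [Finset.sum_sub_distrib]
          exact pow_le_pow_left₀ hκ.le (by linarith) 2
        · rw [zero_mul]
          exact mul_nonneg (hnn ω) (sq_nonneg _)
    _ = ∑ i, ∑ s, π i s * (ξ i s - μ i) ^ 2 :=
        sum_prod_mul_sum_sq (fun i => (hπ i).2) (ζ := fun i s => ξ i s - μ i) hζ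
    _ ≤ _ := by simpa using Finset.sum_le_sum fun i (_ : i ∈ Finset.univ) => hvar i

end ProductWeights

/-! ### Randomness extraction by random coding -/

section Coding

variable {S T D : Type*} [Fintype S] [Fintype T] [Fintype D] [DecidableEq D]

/-- Second-moment bound for a random function `f : S → D` with independent values of law `Q`. -/
theorem sum_prod_mul_abs_le [DecidableEq S] {Q : D → ℝ} (hQ : Q ∈ stdSimplex ℝ D) (a : D)
    {g : S → ℝ} {θ m : ℝ} (hg : ∀ s, 0 ≤ g s) (hθ : 0 ≤ θ) (hgθ : ∀ s, g s ≤ θ * (m * Q a))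
    (hm : ∑ s, g s ≤ m) :
    ∑ f : S → D, (∏ s, Q (f s)) * |∑ s, g s * ((if f s = a then 1 else 0) - Q a)| ≤
      √θ * (m * Q a) := by
  have hm0 : 0 ≤ m := (Finset.sum_nonneg fun s _ => hg s).trans hm
  have hw : ∀ f : S → D, 0 ≤ ∏ s, Q (f s) := fun f => Finset.prod_nonneg fun s _ => hQ.1 _
  have hmean : ∑ x, Q x * ((if x = a then (1 : ℝ) else 0) - Q a) = 0 := by
    simp [mul_sub, Finset.sum_sub_distrib, ← Finset.sum_mul, hQ.2]
  have hsec : ∑ x, Q x * ((if x = a then (1 : ℝ) else 0) - Q a) ^ 2 ≤ Q a := by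
    have : ∀ x, Q x * ((if x = a then (1 : ℝ) else 0) - Q a) ^ 2 =
        (if x = a then Q x * (1 - 2 * Q a) else 0) + Q x * Q a ^ 2 := fun x => by
      split_ifs <;> ring
    simp only [this, Finset.sum_add_distrib, Finset.sum_ite_eq', Finset.mem_univ, if_true,
      ← Finset.sum_mul, hQ.2]
    nlinarith [hQ.1 a, sq_nonneg (Q a)]
  have h2 := sum_prod_mul_sum_sq (ι := S) (π := fun _ => Q) (fun _ => hQ.2)
    (ζ := fun s x => g s * ((if x = a then 1 else 0) - Q a)) fun s => by
      simp only [mul_left_comm _ (g s), ← Finset.mul_sum, hmean, mul_zero]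
  have h3 : ∑ s, ∑ x, Q x * (g s * ((if x = a then 1 else 0) - Q a)) ^ 2 ≤
      θ * (m * Q a) ^ 2 := by
    calc _ ≤ ∑ s, g s * (θ * (m * Q a) * Q a) := by
          refine Finset.sum_le_sum fun s _ => ?_
          simp only [mul_pow, mul_left_comm _ (g s ^ 2), ← Finset.mul_sum]
          calc _ ≤ g s ^ 2 * Q a := mul_le_mul_of_nonneg_left hsec (sq_nonneg _)
            _ = g s * (g s * Q a) := by ring
            _ ≤ _ := mul_le_mul_of_nonneg_left
                (mul_le_mul_of_nonneg_right (hgθ s) (hQ.1 a)) (hg s)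
      _ = (∑ s, g s) * (θ * (m * Q a) * Q a) := by rw [Finset.sum_mul]
      _ ≤ m * (θ * (m * Q a) * Q a) := by
          refine mul_le_mul_of_nonneg_right hm ?_
          have := hQ.1 a
          positivity
      _ = _ := by ring
  -- Cauchy–Schwarz: the squared mean of the absolute value is at most the second moment.
  have h4 := Finset.sum_sq_le_sum_mul_sum_of_sq_le_mul (Finset.univ : Finset (S → D))
    (r := fun f => (∏ s, Q (f s)) * |∑ s, g s * ((if f s = a then 1 else 0) - Q a)|)
    (f := fun f => ∏ s, Q (f s))
    (g := fun f => (∏ s, Q (f s)) * (∑ s, g s * ((if f s = a then 1 else 0) - Q a)) ^ 2)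
    (fun f _ => hw f) (fun f _ => mul_nonneg (hw f) (sq_nonneg _))
    (fun f _ => by rw [mul_pow, sq_abs]; exact le_of_eq (by ring))
  rw [sum_prod_pi fun _ : S => Q, h2] at h4
  simp only [hQ.2, Finset.prod_const_one, one_mul] at h4
  refine (abs_le_of_sq_le_sq' ?_ (mul_nonneg (Real.sqrt_nonneg _) (mul_nonneg hm0 (hQ.1 a)))).2
  rw [mul_pow, Real.sq_sqrt hθ]
  exact h4.trans h3

/-- One-shot randomness extraction: if the conditional probabilities `P(s | t)` are typically much
smaller than `Q(a)`, some function of `s` has conditional law close to `Q` given `t`. -/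
theorem exists_code {P : S × T → ℝ} (hP : P ∈ stdSimplex ℝ (S × T)) {Q : D → ℝ}
    (hQ : Q ∈ stdSimplex ℝ D) {θ : ℝ} (hθ : 0 ≤ θ) :
    ∃ f : S → D, ∑ t, ∑ a, |∑ s, P (s, t) * ((if f s = a then 1 else 0) - Q a)| ≤
      √θ + 2 * ∑ t, ∑ s, ∑ a,
        if θ * ((∑ s', P (s', t)) * Q a) < P (s, t) then P (s, t) * Q a else 0 := by
  classical
  set w : (S → D) → ℝ := fun f => ∏ s, Q (f s) with hwdef
  have hw : ∀ f, 0 ≤ w f := fun f => Finset.prod_nonneg fun s _ => hQ.1 _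
  have hw1 : ∑ f, w f = 1 := by
    rw [hwdef, sum_prod_pi fun _ : S => Q]; simp [hQ.2]
  have key : ∀ t a, ∑ f, w f * |∑ s, P (s, t) * ((if f s = a then 1 else 0) - Q a)| ≤
      √θ * ((∑ s', P (s', t)) * Q a) + 2 * ∑ s,
        if θ * ((∑ s', P (s', t)) * Q a) < P (s, t) then P (s, t) * Q a else 0 := by
    intro t a
    set m := ∑ s', P (s', t) with hm
    have hmQ : 0 ≤ m * Q a := mul_nonneg (Finset.sum_nonneg fun s _ => hP.1 _) (hQ.1 a)
    -- Truncation: atoms below the threshold obey the second-moment bound, while each larger atom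
    -- contributes at most `2 * Q a` times its mass.
    set g : S → ℝ := fun s => if θ * (m * Q a) < P (s, t) then 0 else P (s, t) with hg
    set g' : S → ℝ := fun s => if θ * (m * Q a) < P (s, t) then P (s, t) else 0 with hg'
    have hgg : ∀ s, P (s, t) = g s + g' s := fun s => by
      simp only [hg, hg']; split_ifs <;> simp
    have hg0 : ∀ s, 0 ≤ g s := fun s => by
      simp only [hg]; split_ifs; exacts [le_rfl, hP.1 _]
    have hg0' : ∀ s, 0 ≤ g' s := fun s => by
      simp only [hg']; split_ifs; exacts [hP.1 _, le_rfl]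
    have h1 := sum_prod_mul_abs_le hQ a hg0 hθ (m := m) (fun s => by
      simp only [hg]
      split_ifs with h
      exacts [mul_nonneg hθ hmQ, not_lt.1 h])
      (Finset.sum_le_sum fun s _ => by rw [hgg]; linarith [hg0' s])
    have h2 : ∀ s, ∑ f, w f * |(if f s = a then (1 : ℝ) else 0) - Q a| ≤ 2 * Q a := fun s => by
      rw [sum_prod_mul_apply (π := fun _ => Q) (fun _ => hQ.2) s
        fun x => |(if x = a then (1 : ℝ) else 0) - Q a|]
      calc _ ≤ ∑ x, ((if x = a then Q x else 0) + Q x * Q a) := by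
            refine Finset.sum_le_sum fun x _ => ?_
            have : |(if x = a then (1 : ℝ) else 0) - Q a| ≤ (if x = a then 1 else 0) + Q a := by
              refine (abs_sub _ _).trans_eq ?_
              rw [abs_of_nonneg (hQ.1 a)]
              split_ifs <;> simp
            refine (mul_le_mul_of_nonneg_left this (hQ.1 x)).trans_eq ?_
            split_ifs <;> ring
        _ = _ := by
            simp only [Finset.sum_add_distrib, Finset.sum_ite_eq', Finset.mem_univ, if_true,
              ← Finset.sum_mul, hQ.2]
            ring
    calc _ ≤ ∑ f, (w f * |∑ s, g s * ((if f s = a then 1 else 0) - Q a)| +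
          ∑ s, g' s * (w f * |(if f s = a then (1 : ℝ) else 0) - Q a|)) := by
          refine Finset.sum_le_sum fun f _ => ?_
          simp only [hgg, add_mul, Finset.sum_add_distrib]
          refine (mul_le_mul_of_nonneg_left (abs_add_le _ _) (hw f)).trans ?_
          rw [mul_add]
          refine add_le_add le_rfl ?_
          refine (mul_le_mul_of_nonneg_left (Finset.abs_sum_le_sum_abs _ _) (hw f)).trans_eq ?_
          rw [Finset.mul_sum]
          refine Finset.sum_congr rfl fun s _ => ?_
          rw [abs_mul, abs_of_nonneg (hg0' s)]
          ring
      _ ≤ _ := by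
          rw [Finset.sum_add_distrib, Finset.sum_comm]
          refine add_le_add h1 ?_
          rw [Finset.mul_sum]
          refine Finset.sum_le_sum fun s _ => ?_
          rw [← Finset.mul_sum]
          refine (mul_le_mul_of_nonneg_left (h2 s) (hg0' s)).trans_eq ?_
          simp only [hg']
          split_ifs <;> ring
  by_contra! hcon
  set R := √θ + 2 * ∑ t, ∑ s, ∑ a,
        if θ * ((∑ s', P (s', t)) * Q a) < P (s, t) then P (s, t) * Q a else 0 with hR
  have havg : ∑ f, w f * ∑ t, ∑ a, |∑ s, P (s, t) * ((if f s = a then 1 else 0) - Q a)| ≤ R := by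
    simp only [Finset.mul_sum]
    rw [Finset.sum_comm]
    have h1 : ∀ t, ∑ f, ∑ a, w f * |∑ s, P (s, t) * ((if f s = a then 1 else 0) - Q a)| ≤
        √θ * (∑ s', P (s', t)) + 2 * ∑ s, ∑ a,
          if θ * ((∑ s', P (s', t)) * Q a) < P (s, t) then P (s, t) * Q a else 0 := fun t => by
      rw [Finset.sum_comm]
      refine (Finset.sum_le_sum fun a _ => key t a).trans_eq ?_
      rw [Finset.sum_add_distrib, ← Finset.mul_sum, ← Finset.mul_sum, ← Finset.mul_sum, hQ.2,
        mul_one, Finset.sum_comm]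
    refine (Finset.sum_le_sum fun t _ => h1 t).trans_eq ?_
    rw [Finset.sum_add_distrib, ← Finset.mul_sum, ← Finset.mul_sum,
      ← Fintype.sum_prod_type_right (f := P), hP.2, mul_one]
  -- A code of positive weight is needed to make the averaged inequality strict.
  obtain ⟨f₀, -, hf₀⟩ : ∃ f ∈ (Finset.univ : Finset (S → D)), 0 < w f :=
    Finset.exists_lt_of_sum_lt (by simp [hw1])
  have hlt : ∑ f, w f * R <
      ∑ f, w f * ∑ t, ∑ a, |∑ s, P (s, t) * ((if f s = a then 1 else 0) - Q a)| :=
    Finset.sum_lt_sum (fun f _ => mul_le_mul_of_nonneg_left (hcon f).le (hw f))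
      ⟨f₀, Finset.mem_univ _, mul_lt_mul_of_pos_left (hcon f₀) hf₀⟩
  rw [← Finset.sum_mul, hw1, one_mul] at hlt
  exact absurd havg (not_le.2 hlt)

end Coding

/-! ### Codes for long blocks of signals -/

section BlockCode

open Real

theorem sum_arrow_prod {ι X Y : Type*} [Fintype ι] [DecidableEq ι] [Fintype X] [Fintype Y]
    (F : (ι → X) → (ι → Y) → ℝ) :
    ∑ ω : ι → X × Y, F (fun i => (ω i).1) (fun i => (ω i).2) = ∑ x, ∑ y, F x y := by
  rw [← Fintype.sum_prod_type']
  exact Fintype.sum_equiv (Equiv.arrowProdEquivProdArrow ι (fun _ => X) fun _ => Y) _ _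
    fun _ => rfl

/-- Substituting `√x` reduces this to `|log t * t| < 1` on `(0, 1]`. The constant does not depend on
`x`, so the variance bound for `logRatio` is uniform over all mixed actions. -/
theorem mul_logb_sq_le {x : ℝ} (h0 : 0 ≤ x) (h1 : x ≤ 1) :
    x * logb 2 x ^ 2 ≤ 4 / log 2 ^ 2 := by
  rcases h0.eq_or_lt with rfl | hpos
  · simp only [zero_mul]; positivity
  · have hs : 0 < √x := sqrt_pos.2 hpos
    have hlog : log x = 2 * log (√x) := by rw [log_sqrt h0]; ring
    have h2 : (log (√x) * √x) ^ 2 ≤ 1 := by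
      rw [sq_le_one_iff_abs_le_one]
      exact (abs_log_mul_self_lt _ hs (sqrt_le_one.2 h1)).le
    rw [logb, div_pow, hlog, ← mul_div_assoc]
    refine div_le_div_of_nonneg_right ?_ (sq_nonneg _)
    have h3 : √x ^ 2 = x := sq_sqrt h0
    calc x * (2 * log (√x)) ^ 2 = √x ^ 2 * (2 * log (√x)) ^ 2 := by rw [h3]
      _ = 4 * (log (√x) * √x) ^ 2 := by ring
      _ ≤ 4 := by linarith

theorem prod_mem_stdSimplex {ι Z : Type*} [Fintype ι] [DecidableEq ι] [Fintype Z] {q : ι → Z → ℝ}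
    (hq : ∀ i, q i ∈ stdSimplex ℝ Z) :
    (fun ω : ι → Z => ∏ i, q i (ω i)) ∈ stdSimplex ℝ (ι → Z) :=
  ⟨fun ω => Finset.prod_nonneg fun i _ => (hq i).1 _, by
    rw [sum_prod_pi q]; simp [(hq _).2]⟩

variable {A X Y : Type*} [Fintype A] [Fintype X] [Fintype Y]

theorem prod_pair_mem_stdSimplex {p : X × Y → ℝ} (hp : p ∈ stdSimplex ℝ (X × Y)) (N : ℕ) :
    (fun z : (Fin N → X) × (Fin N → Y) => ∏ i, p (z.1 i, z.2 i)) ∈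
      stdSimplex ℝ ((Fin N → X) × (Fin N → Y)) :=
  ⟨fun z => Finset.prod_nonneg fun i _ => hp.1 _, by
    rw [Fintype.sum_prod_type,
      ← sum_arrow_prod fun (x : Fin N → X) (y : Fin N → Y) => ∏ i, p (x i, y i)]
    exact (prod_mem_stdSimplex fun _ : Fin N => hp).2⟩

/-- The logarithmic ratio whose typical size decides whether a block code exists. -/
noncomputable def logRatio (p : X × Y → ℝ) (q : A → ℝ) (s : (X × Y) × A) : ℝ :=
  logb 2 (p s.1 / ∑ x, p (x, s.1.2)) - logb 2 (q s.2)

theorem sum_mul_logRatio {p : X × Y → ℝ} (hp : p ∈ stdSimplex ℝ (X × Y)) {q : A → ℝ}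
    (hq : q ∈ stdSimplex ℝ A) :
    ∑ s : (X × Y) × A, p s.1 * q s.2 * logRatio p q s = -condEntropy p + entropy q := by
  have h1 : ∑ s : (X × Y) × A, p s.1 * q s.2 * logRatio p q s =
      ∑ z, ∑ a, (p z * logb 2 (p z / ∑ x, p (x, z.2)) * q a - p z * (q a * logb 2 (q a))) := by
    rw [Fintype.sum_prod_type]
    refine Finset.sum_congr rfl fun z _ => Finset.sum_congr rfl fun a _ => ?_
    rw [logRatio]; ring
  simp only [h1, Finset.sum_sub_distrib, ← Finset.mul_sum, ← Finset.sum_mul, hq.2, hp.2, mul_one,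
    one_mul]
  rw [condEntropy, entropy, Fintype.sum_prod_type]
  simp only [Finset.sum_neg_distrib]
  ring

theorem sum_mul_logRatio_sq_le {p : X × Y → ℝ} (hp : p ∈ stdSimplex ℝ (X × Y)) {q : A → ℝ}
    (hq : q ∈ stdSimplex ℝ A) :
    ∑ s : (X × Y) × A, p s.1 * q s.2 * logRatio p q s ^ 2 ≤
      2 * ∑ z, p z * logb 2 (p z / ∑ x, p (x, z.2)) ^ 2 +
        2 * (Fintype.card A * (4 / log 2 ^ 2)) := by
  have h1 : ∀ a, q a * logb 2 (q a) ^ 2 ≤ 4 / log 2 ^ 2 := fun a => by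
    refine mul_logb_sq_le (hq.1 a) ?_
    rw [← hq.2]
    exact Finset.single_le_sum (fun a _ => hq.1 a) (Finset.mem_univ a)
  have h2 : ∑ a, q a * logb 2 (q a) ^ 2 ≤ Fintype.card A * (4 / log 2 ^ 2) := by
    simpa using Finset.sum_le_sum fun a (_ : a ∈ Finset.univ) => h1 a
  calc _ ≤ ∑ z, ∑ a, (2 * (p z * logb 2 (p z / ∑ x, p (x, z.2)) ^ 2) * q a +
        2 * (p z * (q a * logb 2 (q a) ^ 2))) := by
        rw [Fintype.sum_prod_type]
        refine Finset.sum_le_sum fun z _ => Finset.sum_le_sum fun a _ => ?_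
        dsimp only [logRatio]
        generalize logb 2 (p z / ∑ x, p (x, z.2)) = α
        generalize logb 2 (q a) = β
        have h3 := mul_nonneg (hp.1 z) (hq.1 a)
        nlinarith [mul_nonneg h3 (sq_nonneg (α + β))]
    _ ≤ _ := by
        simp only [Finset.sum_add_distrib, ← Finset.mul_sum, ← Finset.sum_mul, hq.2, hp.2,
          mul_one, one_mul]
        linarith

/-- On the support, the bad event forces the sum of the `logRatio`s to be at least `logb 2 θ`, which
exceeds its mean by at least `κ`; Chebyshev's inequality applies. Outcomes of weight zero contribute
nothing. -/
theorem sum_bad_le {p : X × Y → ℝ} (hp : p ∈ stdSimplex ℝ (X × Y)) {N : ℕ} {q : Fin N → A → ℝ}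
    (hq : ∀ i, q i ∈ stdSimplex ℝ A) {θ κ V : ℝ} (hθ : 0 < θ) (hκ : 0 < κ)
    (hκθ : ∑ i, entropy (q i) - N * condEntropy p + κ ≤ logb 2 θ)
    (hV : ∀ i, ∑ s : (X × Y) × A, p s.1 * q i s.2 * logRatio p (q i) s ^ 2 ≤ V) :
    (∑ y : Fin N → Y, ∑ x : Fin N → X, ∑ a : Fin N → A,
      if θ * ((∑ x' : Fin N → X, ∏ i, p (x' i, y i)) * ∏ i, q i (a i)) < ∏ i, p (x i, y i)
        then (∏ i, p (x i, y i)) * ∏ i, q i (a i) else 0) ≤ N * V / κ ^ 2 := by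
  have hπ : ∀ i, (fun s : (X × Y) × A => p s.1 * q i s.2) ∈ stdSimplex ℝ ((X × Y) × A) :=
    fun i => ⟨fun s => mul_nonneg (hp.1 _) ((hq i).1 _), by
      rw [Fintype.sum_prod_type]
      simp only [← Finset.mul_sum, (hq i).2, mul_one, hp.2]⟩
  have hcheb := sum_prod_ite_le hπ (ξ := fun i => logRatio p (q i)) hκ hV
  rw [Fintype.card_fin] at hcheb
  refine le_trans ?_ hcheb
  rw [Finset.sum_comm]
  set F : (Fin N → X) → (Fin N → Y) → (Fin N → A) → ℝ := fun x y a =>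
    if θ * ((∑ x' : Fin N → X, ∏ i, p (x' i, y i)) * ∏ i, q i (a i)) < ∏ i, p (x i, y i)
        then (∏ i, p (x i, y i)) * ∏ i, q i (a i) else 0 with hF
  have h1 : ∑ x : Fin N → X, ∑ y : Fin N → Y, ∑ a : Fin N → A, F x y a =
      ∑ ω : Fin N → (X × Y) × A,
        F (fun i => (ω i).1.1) (fun i => (ω i).1.2) (fun i => (ω i).2) := by
    rw [sum_arrow_prod fun (z : Fin N → X × Y) (a : Fin N → A) =>
      F (fun i => (z i).1) (fun i => (z i).2) a,
      sum_arrow_prod fun (x : Fin N → X) (y : Fin N → Y) => ∑ a : Fin N → A, F x y a]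
  rw [h1]
  refine Finset.sum_le_sum fun ω _ => ?_
  have hnn : 0 ≤ ∏ i, p (ω i).1 * q i (ω i).2 := Finset.prod_nonneg fun i _ => (hπ i).1 _
  simp only [hF]
  split_ifs with hbad hdev hdev
  · rw [← Finset.prod_mul_distrib]
  · rw [← Finset.prod_mul_distrib]
    by_contra! hpos
    refine hdev ?_
    have hpi : ∀ i, 0 < p (ω i).1 * q i (ω i).2 := fun i =>
      ((hπ i).1 _).lt_of_ne fun h0 => hpos.ne' (Finset.prod_eq_zero (Finset.mem_univ i) h0.symm)
    have hp0 : ∀ i, 0 < p (ω i).1 := fun i => pos_of_mul_pos_left (hpi i) ((hq i).1 _)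
    have hq0 : ∀ i, 0 < q i (ω i).2 := fun i => pos_of_mul_pos_right (hpi i) (hp.1 _)
    have hY0 : ∀ i, 0 < ∑ x, p (x, (ω i).1.2) := fun i =>
      (hp0 i).trans_le (Finset.single_le_sum (f := fun x => p (x, (ω i).1.2))
        (fun x _ => hp.1 _) (Finset.mem_univ (ω i).1.1))
    have hlog : ∑ i, logRatio p (q i) (ω i) =
        logb 2 (∏ i, (p (ω i).1 / ∑ x, p (x, (ω i).1.2)) / q i (ω i).2) := by
      rw [logb_prod _ _ fun i _ => (div_pos (div_pos (hp0 i) (hY0 i)) (hq0 i)).ne']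
      refine Finset.sum_congr rfl fun i _ => ?_
      rw [logRatio, logb_div (div_pos (hp0 i) (hY0 i)).ne' (hq0 i).ne']
    have hmean : ∑ i, ∑ s : (X × Y) × A, p s.1 * q i s.2 * logRatio p (q i) s =
        ∑ i, entropy (q i) - N * condEntropy p := by
      simp only [sum_mul_logRatio hp (hq _), Finset.sum_add_distrib, Finset.sum_const,
        Finset.card_univ, Fintype.card_fin, nsmul_eq_mul]
      ring
    rw [hmean, hlog]
    refine hκθ.trans (logb_le_logb_of_le (by norm_num) hθ ?_)
    rw [Finset.prod_div_distrib, Finset.prod_div_distrib, div_div, le_div_iff₀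
      (mul_pos (Finset.prod_pos fun i _ => hY0 i) (Finset.prod_pos fun i _ => hq0 i))]
    rw [sum_prod_pi fun i x => p (x, (ω i).1.2)] at hbad
    exact hbad.le
  · exact hnn
  · exact le_rfl

/-- If the entropy rate of the target actions is below `H(X | Y)`, then functions of long blocks of
Alice's signals simulate the target actions, from the point of view of Bob. -/
theorem exists_block_code [DecidableEq A] {p : X × Y → ℝ} (hp : p ∈ stdSimplex ℝ (X × Y))
    {q : ℕ → A → ℝ} (hq : ∀ i, q i ∈ stdSimplex ℝ A) {h C ε : ℝ} (hh : h < condEntropy p)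
    (hC : ∀ N : ℕ, ∑ i ∈ Finset.range N, entropy (q i) ≤ N * h + C) (hε : 0 < ε) :
    ∃ N₀ : ℕ, ∀ N, N₀ ≤ N → ∃ f : (Fin N → X) → (Fin N → A),
      ∑ y : Fin N → Y, ∑ a : Fin N → A, |∑ x : Fin N → X, (∏ i, p (x i, y i)) *
        ((if f x = a then 1 else 0) - ∏ i : Fin N, q i (a i))| ≤ ε := by
  set V := 2 * ∑ z, p z * logb 2 (p z / ∑ x, p (x, z.2)) ^ 2 +
        2 * (Fintype.card A * (4 / log 2 ^ 2)) with hVdef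
  set η := condEntropy p - h with hη
  have hη0 : 0 < η := sub_pos.2 hh
  -- In `exists_code` the term `√θ` then uses `ε / 2`, and the bad atoms, bounded by `ε / 4` with
  -- factor two, use the rest.
  set θ := (ε / 2) ^ 2 with hθ
  have hθ0 : 0 < θ := by positivity
  obtain ⟨N₁, hN₁⟩ := exists_nat_gt (2 * (C - logb 2 θ) / η)
  obtain ⟨N₂, hN₂⟩ := exists_nat_gt (16 * V / (η ^ 2 * ε))
  refine ⟨max 1 (max N₁ N₂), fun N hN => ?_⟩
  have hN1 : (1 : ℝ) ≤ N := by exact_mod_cast (le_max_left _ _).trans hN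
  have hNN₁ : (N₁ : ℝ) ≤ N := by
    exact_mod_cast ((le_max_left _ _).trans (le_max_right _ _)).trans hN
  have hNN₂ : (N₂ : ℝ) ≤ N := by
    exact_mod_cast ((le_max_right _ _).trans (le_max_right _ _)).trans hN
  have h1 : 2 * (C - logb 2 θ) < N * η := by
    rw [← div_lt_iff₀ hη0]; exact hN₁.trans_le hNN₁
  have h2 : 16 * V < N * (η ^ 2 * ε) := by
    rw [← div_lt_iff₀ (by positivity)]; exact hN₂.trans_le hNN₂
  have hκ0 : 0 < N * η / 2 := by positivity
  have hbad := sum_bad_le hp (q := fun i : Fin N => q i) (fun i => hq i) (κ := N * η / 2)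
    hθ0 hκ0 (by
      rw [Fin.sum_univ_eq_sum_range fun i => entropy (q i)]
      have h3 := hC N
      have h4 : (N : ℝ) * η = N * condEntropy p - N * h := by rw [hη]; ring
      linarith) fun i => sum_mul_logRatio_sq_le hp (hq i)
  obtain ⟨f, hf⟩ := exists_code (prod_pair_mem_stdSimplex hp N)
    (prod_mem_stdSimplex fun i : Fin N => hq i) hθ0.le
  refine ⟨f, hf.trans ?_⟩
  rw [sqrt_sq (by positivity)]
  have h5 : N * V / (N * η / 2) ^ 2 ≤ ε / 4 := by
    rw [div_le_iff₀ (by positivity)]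
    have h6 := mul_le_mul_of_nonneg_left h2.le (show (0 : ℝ) ≤ N by positivity)
    nlinarith
  have h7 := hbad.trans h5
  linarith

end BlockCode

/-! ### Block strategies -/

section Blocks

variable {A B X Y : Type*}

/-- Alice plays the action sequence `a` in the first `N` stages, and continues in a way that depends
on the signals received meanwhile. -/
def openLoop {m : ℕ} : (N : ℕ) → (Fin N → A) → ((Fin N → X) → Strategy A B X A m) →
    Strategy A B X A (m + N)
  | 0, _, k => k Fin.elim0
  | N + 1, a, k => Strategy.prepend (n := m + N) (fun _ => a 0) fun x _ =>
      openLoop N (fun i => a i.succ) fun s => k (Fin.cons (α := fun _ => X) x s)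

/-- Bob's continuation after `N` stages in which Alice plays `a`. -/
def afterBlock {m : ℕ} : (N : ℕ) → (Fin N → A) → Strategy A B Y B (m + N) → (Fin N → Y) →
    Strategy A B Y B m
  | 0, _, τ, _ => τ
  | N + 1, a, τ, y => afterBlock N (fun i => a i.succ)
      (Strategy.next (n := m + N) τ (y 0) (a 0, Strategy.first (n := m + N) τ (y 0)))
      fun i => y i.succ

variable [Fintype X] [Fintype Y]

/-- The expected total payoff of the first `N` stages, in which Alice plays `a`. -/
noncomputable def blockPayoff (u : A → B → ℝ) (p : X × Y → ℝ) {m : ℕ} :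
    (N : ℕ) → (Fin N → A) → Strategy A B Y B (m + N) → ℝ
  | 0, _, _ => 0
  | N + 1, a, τ => ∑ z : X × Y, p z * (u (a 0) (Strategy.first (n := m + N) τ z.2) +
      blockPayoff u p N (fun i => a i.succ)
        (Strategy.next (n := m + N) τ z.2 (a 0, Strategy.first (n := m + N) τ z.2)))

/-- While `a` is fixed, Alice's signals during the block do not influence her play there, so they
remain a fresh seed, with Bob's signals `y` as his side information. -/
theorem totalPayoff_openLoop (u : A → B → ℝ) (p : X × Y → ℝ) {m N : ℕ}
    (a : Fin N → A) (k : (Fin N → X) → Strategy A B X A m) (τ : Strategy A B Y B (m + N)) :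
    totalPayoff u p (openLoop N a k) τ = blockPayoff u p N a τ +
      ∑ ω : Fin N → X × Y, (∏ i, p (ω i)) *
        totalPayoff u p (k fun i => (ω i).1) (afterBlock N a τ fun i => (ω i).2) := by
  induction N with
  | zero =>
    have hk : ∀ ω : Fin 0 → X × Y, (fun i => (ω i).1) = (Fin.elim0 : Fin 0 → X) := fun ω =>
      funext fun i => i.elim0
    simp [openLoop, blockPayoff, afterBlock, hk]
  | succ N ih =>
    rw [sum_fin_succ, blockPayoff, openLoop, ← Finset.sum_add_distrib]
    change totalPayoff (n := m + N + 1) u p _ τ = _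
    rw [totalPayoff]
    refine Finset.sum_congr rfl fun z _ => ?_
    simp only [Strategy.first_prepend, Strategy.next_prepend, ih, Fin.prod_univ_succ,
      Fin.cons_zero, Fin.cons_succ, afterBlock, mul_add, Finset.mul_sum, mul_assoc]
    rw [add_assoc]
    congr 2
    refine Finset.sum_congr rfl fun ω _ => ?_
    congr 4
    funext i
    refine Fin.cases ?_ (fun j => ?_) i <;> simp

theorem abs_blockPayoff_le {u : A → B → ℝ} {p : X × Y → ℝ} (hp : p ∈ stdSimplex ℝ (X × Y))
    {M : ℝ} (hu : ∀ a b, |u a b| ≤ M) {m N : ℕ} (a : Fin N → A)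
    (τ : Strategy A B Y B (m + N)) : |blockPayoff u p N a τ| ≤ N * M := by
  induction N with
  | zero => simp [blockPayoff]
  | succ N ih =>
    rw [blockPayoff]
    calc _ ≤ ∑ z, p z * (((N + 1 : ℕ) : ℝ) * M) := by
          refine (Finset.abs_sum_le_sum_abs _ _).trans (Finset.sum_le_sum fun z _ => ?_)
          rw [abs_mul, abs_of_nonneg (hp.1 z)]
          refine mul_le_mul_of_nonneg_left ?_ (hp.1 z)
          refine (abs_add_le _ _).trans ?_
          push_cast
          refine (add_le_add (hu _ _) (ih _ _)).trans_eq ?_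
          ring
      _ = _ := by rw [← Finset.sum_mul, hp.2, one_mul]

variable [Fintype A] [Fintype B] [Nonempty B]

/-- Against independent mixed actions, every strategy of Bob concedes the security levels. -/
theorem sum_securityA_le_sum_blockPayoff {u : A → B → ℝ} {p : X × Y → ℝ}
    (hp : p ∈ stdSimplex ℝ (X × Y)) {m N : ℕ} {q : Fin N → A → ℝ}
    (hq : ∀ i, q i ∈ stdSimplex ℝ A) (τ : Strategy A B Y B (m + N)) :
    ∑ i, securityA u (q i) ≤ ∑ a : Fin N → A, (∏ i, q i (a i)) * blockPayoff u p N a τ := by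
  induction N with
  | zero => simp [blockPayoff]
  | succ N ih =>
    have hprod : ∑ a : Fin N → A, ∏ i, q i.succ (a i) = 1 :=
      (prod_mem_stdSimplex fun i : Fin N => hq i.succ).2
    have key : ∀ z : X × Y, ∑ i, securityA u (q i) ≤ ∑ a₀, ∑ a : Fin N → A,
        q 0 a₀ * (∏ i, q i.succ (a i)) * (u a₀ (Strategy.first (n := m + N) τ z.2) +
          blockPayoff u p N a (Strategy.next (n := m + N) τ z.2
            (a₀, Strategy.first (n := m + N) τ z.2))) := by
      intro z
      rw [Fin.sum_univ_succ]
      have h1 : ∀ a₀, q 0 a₀ * (u a₀ (Strategy.first (n := m + N) τ z.2) +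
          ∑ i : Fin N, securityA u (q i.succ)) ≤ ∑ a : Fin N → A,
        q 0 a₀ * (∏ i, q i.succ (a i)) * (u a₀ (Strategy.first (n := m + N) τ z.2) +
          blockPayoff u p N a (Strategy.next (n := m + N) τ z.2
            (a₀, Strategy.first (n := m + N) τ z.2))) := by
        intro a₀
        simp only [mul_assoc, ← Finset.mul_sum]
        refine mul_le_mul_of_nonneg_left ?_ ((hq 0).1 a₀)
        simp only [mul_add, Finset.sum_add_distrib, ← Finset.sum_mul, hprod, one_mul]
        exact add_le_add le_rfl (ih (fun i => hq i.succ) _)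
      refine le_trans ?_ (Finset.sum_le_sum fun a₀ _ => h1 a₀)
      simp only [mul_add, Finset.sum_add_distrib, ← Finset.sum_mul, (hq 0).2, one_mul]
      exact add_le_add (securityA_le u (q 0) _) le_rfl
    calc ∑ i, securityA u (q i) = ∑ z, p z * ∑ i, securityA u (q i) := by
          rw [← Finset.sum_mul, hp.2, one_mul]
      _ ≤ _ := Finset.sum_le_sum fun z _ => mul_le_mul_of_nonneg_left (key z) (hp.1 z)
      _ = _ := by
          rw [sum_fin_succ]
          simp only [blockPayoff, Fin.prod_univ_succ, Fin.cons_zero, Fin.cons_succ,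
            Finset.mul_sum]
          rw [Finset.sum_comm]
          refine Finset.sum_congr rfl fun a₀ _ => ?_
          rw [Finset.sum_comm]
          refine Finset.sum_congr rfl fun a _ => Finset.sum_congr rfl fun z _ => ?_
          ring

variable [DecidableEq A]

/-- For each `y`, replace the law of the coded actions by the product law. Block payoffs are bounded
by `N * M`, so the total cost is `N * M` times the `L¹` error. Bob may know the seed's `y`, hence
the dependence of `τ` on it. -/
theorem le_sum_blockPayoff_code {u : A → B → ℝ} {p : X × Y → ℝ}
    (hp : p ∈ stdSimplex ℝ (X × Y)) {M : ℝ} (hu : ∀ a b, |u a b| ≤ M) (hM : 0 ≤ M) {m N : ℕ}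
    {q : Fin N → A → ℝ} (hq : ∀ i, q i ∈ stdSimplex ℝ A) {f : (Fin N → X) → (Fin N → A)} {ε : ℝ}
    (hf : ∑ y : Fin N → Y, ∑ a : Fin N → A, |∑ x : Fin N → X, (∏ i, p (x i, y i)) *
        ((if f x = a then 1 else 0) - ∏ i, q i (a i))| ≤ ε)
    (τ : (Fin N → Y) → Strategy A B Y B (m + N)) :
    ∑ i, securityA u (q i) - N * M * ε ≤ ∑ ω : Fin N → X × Y, (∏ i, p (ω i)) *
      blockPayoff u p N (f fun i => (ω i).1) (τ fun i => (ω i).2) := by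
  rw [sum_arrow_prod fun (x : Fin N → X) (y : Fin N → Y) => (∏ i, p (x i, y i)) *
      blockPayoff u p N (f x) (τ y), Finset.sum_comm]
  have h1 : ∀ y, ∑ x : Fin N → X, (∏ i, p (x i, y i)) * blockPayoff u p N (f x) (τ y) =
      ∑ a : Fin N → A, (∑ x : Fin N → X, (∏ i, p (x i, y i)) *
        ((if f x = a then 1 else 0) - ∏ i, q i (a i))) * blockPayoff u p N a (τ y) +
      (∑ x : Fin N → X, ∏ i, p (x i, y i)) *
        ∑ a : Fin N → A, (∏ i, q i (a i)) * blockPayoff u p N a (τ y) := by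
    intro y
    simp only [mul_sub, Finset.sum_sub_distrib, sub_mul, Finset.sum_mul]
    rw [Finset.sum_comm]
    have : ∀ x : Fin N → X, ∑ a : Fin N → A, ((∏ i, p (x i, y i)) * if f x = a then 1 else 0) *
        blockPayoff u p N a (τ y) = (∏ i, p (x i, y i)) * blockPayoff u p N (f x) (τ y) :=
      fun x => by simp
    simp only [this]
    rw [Finset.sum_comm (f := fun (a : Fin N → A) (x : Fin N → X) =>
      (∏ i, p (x i, y i)) * (∏ i, q i (a i)) * blockPayoff u p N a (τ y))]
    simp only [Finset.mul_sum, mul_assoc, sub_add_cancel]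
  have h2 : ∀ y, -(N * M * ∑ a : Fin N → A, |∑ x : Fin N → X, (∏ i, p (x i, y i)) *
        ((if f x = a then 1 else 0) - ∏ i, q i (a i))|) ≤
      ∑ a : Fin N → A, (∑ x : Fin N → X, (∏ i, p (x i, y i)) *
        ((if f x = a then 1 else 0) - ∏ i, q i (a i))) * blockPayoff u p N a (τ y) := by
    intro y
    refine neg_le_of_abs_le ((Finset.abs_sum_le_sum_abs _ _).trans ?_)
    rw [Finset.mul_sum]
    refine Finset.sum_le_sum fun a _ => ?_
    rw [abs_mul, mul_comm]
    exact mul_le_mul_of_nonneg_right (abs_blockPayoff_le hp hu a (τ y)) (abs_nonneg _)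
  have h3 : ∀ y, (∑ x : Fin N → X, ∏ i, p (x i, y i)) * ∑ i, securityA u (q i) ≤
      (∑ x : Fin N → X, ∏ i, p (x i, y i)) *
        ∑ a : Fin N → A, (∏ i, q i (a i)) * blockPayoff u p N a (τ y) := fun y =>
    mul_le_mul_of_nonneg_left (sum_securityA_le_sum_blockPayoff hp hq (τ y))
      (Finset.sum_nonneg fun x _ => Finset.prod_nonneg fun i _ => hp.1 _)
  have h4 := Finset.sum_le_sum fun y (_ : y ∈ Finset.univ) => add_le_add (h2 y) (h3 y)
  simp only [← h1] at h4
  refine le_trans ?_ h4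
  have h5 : ∑ y : Fin N → Y, ∑ x : Fin N → X, ∏ i, p (x i, y i) = 1 := by
    have := (prod_pair_mem_stdSimplex hp N).2
    rwa [Fintype.sum_prod_type_right] at this
  rw [Finset.sum_add_distrib, ← Finset.sum_mul, h5, one_mul, Finset.sum_neg_distrib,
    ← Finset.mul_sum]
  have h6 := mul_le_mul_of_nonneg_left hf (show 0 ≤ (N : ℝ) * M by positivity)
  linarith

/-- The block strategy: in each block Alice plays a function of her signals in the block before. -/
theorem exists_seeded_strategy [Nonempty A] {u : A → B → ℝ} {p : X × Y → ℝ}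
    (hp : p ∈ stdSimplex ℝ (X × Y)) {M : ℝ} (hu : ∀ a b, |u a b| ≤ M) (hM : 0 ≤ M) {N : ℕ}
    (hN : 0 < N) {q : Fin N → A → ℝ} (hq : ∀ i, q i ∈ stdSimplex ℝ A)
    {f : (Fin N → X) → (Fin N → A)} {ε w : ℝ}
    (hf : ∑ y : Fin N → Y, ∑ a : Fin N → A, |∑ x : Fin N → X, (∏ i, p (x i, y i)) *
        ((if f x = a then 1 else 0) - ∏ i, q i (a i))| ≤ ε)
    (hw : N * w ≤ ∑ i, securityA u (q i) - N * M * ε) (hwM : w ≤ M) (n : ℕ) :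
    ∃ σ : (Fin N → X) → Strategy A B X A n, ∀ τ : (Fin N → Y) → Strategy A B Y B n,
      n * w - 2 * N * M ≤ ∑ ω : Fin N → X × Y, (∏ i, p (ω i)) *
        totalPayoff u p (σ fun i => (ω i).1) (τ fun i => (ω i).2) := by
  have hP : ∑ ω : Fin N → X × Y, ∏ i, p (ω i) = 1 := (prod_mem_stdSimplex fun _ : Fin N => hp).2
  have hP0 : ∀ ω : Fin N → X × Y, 0 ≤ ∏ i, p (ω i) := fun ω =>
    Finset.prod_nonneg fun i _ => hp.1 _
  induction n using Nat.strong_induction_on with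
  | _ n ih =>
    rcases lt_or_ge n N with hn | hn
    -- An incomplete last block is played arbitrarily; this is the source of the loss `2 * N * M`.
    · refine ⟨fun _ _ _ _ => Classical.arbitrary A, fun τ => ?_⟩
      calc _ ≤ ∑ ω : Fin N → X × Y, (∏ i, p (ω i)) * -(n * M) := by
            rw [← Finset.sum_mul, hP, one_mul]
            have h1 : (n : ℝ) * w ≤ n * M := by gcongr
            have h2 : (n : ℝ) * M ≤ N * M := by gcongr
            linarith
        _ ≤ _ := Finset.sum_le_sum fun ω _ => mul_le_mul_of_nonneg_left
            (neg_le_of_abs_le (abs_totalPayoff_le hp hu _ _)) (hP0 ω)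
    · obtain ⟨k, rfl⟩ := Nat.exists_eq_add_of_le' hn
      obtain ⟨σ, hσ⟩ := ih k (by omega)
      refine ⟨fun s => openLoop N (f s) σ, fun τ => ?_⟩
      simp only [totalPayoff_openLoop, mul_add, Finset.sum_add_distrib]
      have h1 := le_sum_blockPayoff_code hp hu hM hq hf τ
      -- For each fixed old seed `ω`, Bob's continuation is a family indexed by his new signals, and
      -- the new seed is independent of `ω`, so the induction hypothesis applies.
      have h2 : k * w - 2 * N * M ≤ ∑ ω : Fin N → X × Y, (∏ i, p (ω i)) *
          ∑ ω' : Fin N → X × Y, (∏ i, p (ω' i)) * totalPayoff u p (σ fun i => (ω' i).1)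
            (afterBlock N (f fun i => (ω i).1) (τ fun i => (ω i).2) fun i => (ω' i).2) := by
        calc _ = ∑ ω : Fin N → X × Y, (∏ i, p (ω i)) * (k * w - 2 * N * M) := by
              rw [← Finset.sum_mul, hP, one_mul]
          _ ≤ _ := Finset.sum_le_sum fun ω _ => mul_le_mul_of_nonneg_left
              (hσ fun y => afterBlock N (f fun i => (ω i).1) (τ fun i => (ω i).2) y) (hP0 ω)
      push_cast
      linarith

end Blocks

/-! ### Securing the envelope -/

section Achievability

variable {A B X Y : Type*} [Fintype X] [Fintype Y]

theorem exists_abs_le {A B : Type*} [Fintype A] [Fintype B] (u : A → B → ℝ) : ∃ M, 0 ≤ M ∧ ∀ a b, |u a b| ≤ M :=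
  ⟨∑ a, ∑ b, |u a b|, by positivity, fun a b =>
    (Finset.single_le_sum (f := fun b => |u a b|) (fun _ _ => abs_nonneg _)
      (Finset.mem_univ b)).trans (Finset.single_le_sum (f := fun a => ∑ b, |u a b|)
        (fun _ _ => Finset.sum_nonneg fun _ _ => abs_nonneg _) (Finset.mem_univ a))⟩

theorem le_totalPayoff_const {u : A → B → ℝ} {p : X × Y → ℝ} (hp : p ∈ stdSimplex ℝ (X × Y))
    {a : A} {v : ℝ} (hv : ∀ b, v ≤ u a b) {n : ℕ} (τ : Strategy A B Y B n) :
    n * v ≤ totalPayoff u p (fun _ _ _ => a : Strategy A B X A n) τ := by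
  induction n with
  | zero => simp [totalPayoff]
  | succ n ih =>
    change _ ≤ ∑ z, p z * (u a (τ.first z.2) +
      totalPayoff u p (fun _ _ _ => a : Strategy A B X A n) (τ.next z.2 (a, τ.first z.2)))
    calc ((n + 1 : ℕ) : ℝ) * v = ∑ z, p z * (v + n * v) := by
          rw [← Finset.sum_mul, hp.2]; push_cast; ring
      _ ≤ _ := Finset.sum_le_sum fun z _ =>
          mul_le_mul_of_nonneg_left (add_le_add (hv _) (ih _)) (hp.1 z)

variable [Fintype A] [Fintype B] [Nonempty A] [Nonempty B]

/-- Alice can secure the concave envelope at `H(X | Y)`, up to an arbitrarily small loss per stage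
and a bounded total loss. -/
theorem exists_securing_strategy {u : A → B → ℝ} {p : X × Y → ℝ}
    (hp : p ∈ stdSimplex ℝ (X × Y)) {δ : ℝ} (hδ : 0 < δ) :
    ∃ C : ℝ, ∀ n : ℕ, ∃ σ : Strategy A B X A n, ∀ τ : Strategy A B Y B n,
      n * (upperConcaveEnvelope (valueA u) (condEntropy p) - δ) - C ≤ totalPayoff u p σ τ := by
  classical
  obtain ⟨M, hM, hu⟩ := exists_abs_le u
  set J := upperConcaveEnvelope (valueA u) (condEntropy p) with hJ
  rcases (condEntropy_nonneg hp.1).eq_or_lt with h0 | hpos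
  · have hJ0 : J ≤ valueA u 0 := by
      have hg : ConcaveOn ℝ (Set.Ici 0) fun x : ℝ => valueA u 0 + 2 * M * x :=
        ⟨convex_Ici 0, fun x _ y _ s t _ _ hst => le_of_eq (by
          simp only [smul_eq_mul]
          linear_combination valueA u 0 * hst)⟩
      have h1 := upperConcaveEnvelope_le (f := valueA u) (h := 0)
        (fun x hx => neg_bound_le_valueA hu hx) hg (fun x hx => le_of_forall_lt fun w hw => by
          obtain ⟨q, hq, hqx, hlt⟩ := exists_lt_securityA hx hw
          have h2 := securityA_le_valueA_zero_add hu hq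
          have h3 := mul_le_mul_of_nonneg_left hqx (show 0 ≤ 2 * M by positivity)
          linarith) le_rfl
      rw [hJ, ← h0]
      simpa using h1
    obtain ⟨q, hq, hq0, hlt⟩ := exists_lt_securityA (u := u) le_rfl
      (show J - δ < valueA u 0 by linarith)
    -- Zero entropy forces `q` to be concentrated at `a`, so a constant action suffices.
    obtain ⟨a, ha⟩ := exists_one_sub_le_entropy hq
    refine ⟨0, fun n => ⟨fun _ _ _ => a, fun τ => ?_⟩⟩
    rw [sub_zero]
    refine le_totalPayoff_const hp (fun b => ?_) τ
    refine hlt.le.trans ((securityA_le u q b).trans_eq ?_)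
    have hrest : ∑ i ∈ Finset.univ.erase a, q i = 0 := by
      refine le_antisymm ?_ (Finset.sum_nonneg fun i _ => hq.1 i)
      have := Finset.add_sum_erase Finset.univ q (Finset.mem_univ a)
      rw [hq.2] at this
      linarith
    have hz : ∀ i, i ≠ a → q i = 0 := fun i hi =>
      (Finset.sum_eq_zero_iff_of_nonneg fun i _ => hq.1 i).1 hrest i
        (Finset.mem_erase.2 ⟨hi, Finset.mem_univ i⟩)
    have h1 : q a = 1 := by
      rw [← hq.2]
      exact (Finset.sum_eq_single a (fun i _ hi => hz i hi) (by simp)).symm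
    rw [Finset.sum_eq_single a (fun i _ hi => by rw [hz i hi, zero_mul]) (by simp), h1, one_mul]
  · obtain ⟨h', hh', q, hq, C₀, hC₀⟩ := exists_sustainable_of_lt_envelope hu hpos
      (show J - δ / 2 < J by linarith)
    -- The loss `δ` per stage is shared out: `δ / 2` below the envelope, `δ / 4` for coding, `δ / 4`
    -- for the time-sharing constant `C₀`.
    have hε : 0 < δ / (4 * (M + 1)) := by positivity
    obtain ⟨N₀, hN₀⟩ := exists_block_code hp hq hh' (fun N => (hC₀ N).1) hε
    obtain ⟨N₁, hN₁⟩ := exists_nat_gt (4 * C₀ / δ)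
    set N := max (max N₀ N₁) 1 with hNdef
    have hNpos : 0 < N := lt_of_lt_of_le one_pos (le_max_right _ _)
    obtain ⟨f, hf⟩ := hN₀ N ((le_max_left _ _).trans (le_max_left _ _))
    have hNN₁ : (N₁ : ℝ) ≤ N := by
      exact_mod_cast (le_max_right N₀ N₁).trans (le_max_left _ _)
    have hC₁ : 4 * C₀ < N * δ := by
      rw [← div_lt_iff₀ hδ]; exact hN₁.trans_le hNN₁
    have hεM : M * (δ / (4 * (M + 1))) ≤ δ / 4 := by
      rw [mul_div_assoc', div_le_div_iff₀ (by positivity) (by norm_num)]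
      nlinarith
    have hw : N * (J - δ) ≤ ∑ i : Fin N, securityA u (q i) - N * M * (δ / (4 * (M + 1))) := by
      rw [Fin.sum_univ_eq_sum_range fun i => securityA u (q i)]
      have h1 := (hC₀ N).2
      have h2 := mul_le_mul_of_nonneg_left hεM (show (0 : ℝ) ≤ N by positivity)
      linarith
    have hwM : J - δ ≤ M := by
      linarith [(sustainable_of_lt_envelope hu hpos.le
        (show J - δ / 2 < J by linarith)).le_bound hu]
    refine ⟨4 * N * M, fun n => ?_⟩
    rcases lt_or_ge n N with hn | hn
    · refine ⟨fun _ _ _ => Classical.arbitrary A, fun τ => ?_⟩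
      have h1 : (n : ℝ) * (J - δ) ≤ n * M := by gcongr
      have h2 : (n : ℝ) * M ≤ N * M := by gcongr
      have h3 := neg_le_of_abs_le (abs_totalPayoff_le hp hu
        (fun _ _ _ => Classical.arbitrary A : Strategy A B X A n) τ)
      have h4 : 0 ≤ (N : ℝ) * M := by positivity
      linarith
    · obtain ⟨k, rfl⟩ := Nat.exists_eq_add_of_le' hn
      obtain ⟨σ, hσ⟩ := exists_seeded_strategy hp hu hM hNpos (fun i : Fin N => hq i) hf hw hwM k
      -- The first block only collects a seed; it costs at most `2 * N * M` relative to the target.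
      refine ⟨openLoop N (fun _ => Classical.arbitrary A) σ, fun τ => ?_⟩
      rw [totalPayoff_openLoop]
      have h1 := neg_le_of_abs_le (abs_blockPayoff_le hp hu
        (fun _ : Fin N => Classical.arbitrary A) τ)
      have h2 := hσ fun y => afterBlock N (fun _ => Classical.arbitrary A) τ y
      have h3 : (N : ℝ) * (J - δ) ≤ N * M := by gcongr
      push_cast
      linarith

end Achievability

/-! ### Agreed paths and punishment -/

section Trigger

variable {A B S C : Type*}

theorem Strategy.swap_prepend {n : ℕ} (f : S → C) (k : S → A × B → Strategy A B S C n) :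
    (Strategy.prepend f k).swap = Strategy.prepend f fun s d => (k s d.swap).swap := by
  funext t
  obtain ⟨t, ht⟩ := t
  cases t <;> rfl

open Classical in
/-- Play along the agreed sequence of action pairs as long as nobody deviates from it; after a
deviation, use the given strategy for the remaining stages. -/
noncomputable def trigger (own : A × B → C) (punish : (m : ℕ) → Strategy A B S C m) :
    (n : ℕ) → (ℕ → A × B) → Strategy A B S C n
  | 0, _ => fun t => t.elim0
  | n + 1, c => Strategy.prepend (fun _ => own (c 0)) fun _ d =>
      if d = c 0 then trigger own punish n fun i => c (i + 1) else punish n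

theorem swap_trigger (own : A × B → C) (punish : (m : ℕ) → Strategy A B S C m) (n : ℕ)
    (c : ℕ → A × B) : (trigger own punish n c).swap =
      trigger (fun d => own d.swap) (fun m => (punish m).swap) n fun i => (c i).swap := by
  induction n generalizing c with
  | zero => funext t; exact t.elim0
  | succ n ih =>
    simp only [trigger, Strategy.swap_prepend, Prod.swap_swap, ← ih]
    congr 1
    funext s d
    by_cases h : d = (c 0).swap
    · simp [h]
    · rw [if_neg h, if_neg fun h' => h (by rw [← h', Prod.swap_swap])]

variable {X Y : Type*} [Fintype X] [Fintype Y] {u : A → B → ℝ} {p : X × Y → ℝ}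

theorem totalPayoff_trigger (hp : ∑ z, p z = 1) (PA : (m : ℕ) → Strategy A B X A m)
    (PB : (m : ℕ) → Strategy A B Y B m) (n : ℕ) (c : ℕ → A × B) :
    totalPayoff u p (trigger Prod.fst PA n c) (trigger Prod.snd PB n c) =
      ∑ i ∈ Finset.range n, u (c i).1 (c i).2 := by
  induction n generalizing c with
  | zero => simp [totalPayoff]
  | succ n ih =>
    simp only [totalPayoff, trigger, Strategy.first_prepend, Strategy.next_prepend, if_true, ih,
      Prod.mk.eta, ← Finset.sum_mul, hp, one_mul]
    rw [Finset.sum_range_succ', add_comm]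

/-- Up to the deviation the path is at most `K` short of the target, the deviating stage loses at
most `2 * M`, and punishment loses at most `D`. This works because every prefix of the path, not
just the whole, is controlled. -/
theorem le_totalPayoff_trigger (hp : p ∈ stdSimplex ℝ (X × Y)) {M w D : ℝ}
    (hu : ∀ a b, |u a b| ≤ M) (hw : w ≤ M) {PA : (m : ℕ) → Strategy A B X A m}
    (hPA : ∀ m (τ : Strategy A B Y B m), m * w - D ≤ totalPayoff u p (PA m) τ) (n : ℕ)
    {c : ℕ → A × B} {K : ℝ} (hc : ∀ k : ℕ, k * w - K ≤ ∑ i ∈ Finset.range k, u (c i).1 (c i).2)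
    (hD : 0 ≤ D) (τ : Strategy A B Y B n) :
    n * w - K - D - 2 * M ≤ totalPayoff u p (trigger Prod.fst PA n c) τ := by
  induction n generalizing c K with
  | zero =>
    have h0 := hc 0
    have hM : 0 ≤ M := (abs_nonneg _).trans (hu (c 0).1 (c 0).2)
    simp only [Nat.cast_zero, zero_mul, zero_sub, Finset.range_zero, Finset.sum_empty] at h0 ⊢
    rw [totalPayoff]
    linarith
  | succ n ih =>
    have hK : 0 ≤ K := by simpa using hc 0
    simp only [totalPayoff, trigger, Strategy.first_prepend, Strategy.next_prepend]
    calc _ = ∑ z, p z * (((n + 1 : ℕ) : ℝ) * w - K - D - 2 * M) := by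
          rw [← Finset.sum_mul, hp.2, one_mul]
      _ ≤ _ := by
          refine Finset.sum_le_sum fun z _ => mul_le_mul_of_nonneg_left ?_ (hp.1 z)
          push_cast
          split_ifs with h
          · have hb : τ.first z.2 = (c 0).2 := congrArg Prod.snd h
            -- The surplus of the stage just played over `w` is carried into the allowance for the
            -- shifted path.
            have h1 := ih (c := fun i => c (i + 1)) (K := K + u (c 0).1 (c 0).2 - w) (fun k => by
              have := hc (k + 1)
              rw [Finset.sum_range_succ'] at this
              push_cast at this
              linarith) (τ.next z.2 ((c 0).1, τ.first z.2))
            rw [hb] at h1 ⊢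
            linarith
          · have h1 := hPA n (τ.next z.2 ((c 0).1, τ.first z.2))
            have h2 := neg_le_of_abs_le (hu (c 0).1 (τ.first z.2))
            linarith

/-- Greedy choice: take `x₂` when the accumulated excess over `v` is nonpositive and `x₁` otherwise,
so the excess never leaves a bounded interval. -/
theorem exists_seq_abs_sum_sub_le {γ : Type*} (F : γ → ℝ) {v : ℝ} {x₁ x₂ : γ} (h₁ : F x₁ ≤ v)
    (h₂ : v ≤ F x₂) : ∃ c : ℕ → γ, ∃ K, ∀ k : ℕ, |∑ i ∈ Finset.range k, F (c i) - k * v| ≤ K := by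
  classical
  let s : ℕ → ℝ := fun k => Nat.rec (motive := fun _ => ℝ) 0 (fun _ r => r + (F (if r ≤ 0 then x₂ else x₁) - v)) k
  have hs : ∀ k, s (k + 1) = s k + (F (if s k ≤ 0 then x₂ else x₁) - v) := fun k => rfl
  refine ⟨fun i => if s i ≤ 0 then x₂ else x₁, (F x₂ - v) + (v - F x₁), fun k => ?_⟩
  have hsum : ∑ i ∈ Finset.range k, F (if s i ≤ 0 then x₂ else x₁) - k * v = s k := by
    induction k with
    | zero => simp [s]
    | succ k ih =>
      rw [Finset.sum_range_succ, hs, ← ih]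
      push_cast
      ring
  rw [hsum]
  induction k with
  | zero => simpa [s] using h₁.trans h₂
  | succ k ih =>
    have h3 := ih (by
      have := hsum
      rw [Finset.sum_range_succ, hs] at this
      push_cast at this
      linarith)
    rw [abs_le] at h3 ⊢
    rw [hs]
    split_ifs with h
    · constructor <;> linarith
    · constructor <;> linarith

end Trigger

/-! ### The two directions -/

section Main

variable {A B : Type*} [Fintype A] [Fintype B] [Nonempty A] [Nonempty B]

/-- Together with its exchanged version, this places the target `v` between two entries of the
payoff table, so that a path can track it. -/
theorem exists_payoff_le_envelope {u : A → B → ℝ} {M : ℝ} (hu : ∀ a b, |u a b| ≤ M) {h : ℝ}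
    (hh : 0 ≤ h) : ∃ a b, u a b ≤ upperConcaveEnvelope (valueA u) h := by
  classical
  set a := Classical.arbitrary A
  obtain ⟨b, -, hb⟩ := Finset.exists_mem_eq_inf' (s := (Finset.univ : Finset B))
    Finset.univ_nonempty fun b => ∑ i, (Pi.single a (1 : ℝ) : A → ℝ) i * u i b
  refine ⟨a, b, ?_⟩
  have h1 : securityA u (Pi.single a 1) = u a b := by
    rw [securityA, hb]
    simp [Pi.single_apply]
  rw [← h1]
  exact (le_valueA hu (single_mem_stdSimplex ℝ a) ((entropy_single a).trans_le hh)).trans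
    (le_upperConcaveEnvelope (fun x hx => valueA_le hu hx) hh)

variable {X Y : Type*} [Fintype X] [Fintype Y] {u : A → B → ℝ} {p : X × Y → ℝ}

theorem prodSwap_mem_stdSimplex (hp : p ∈ stdSimplex ℝ (X × Y)) :
    (fun z : Y × X => p (z.2, z.1)) ∈ stdSimplex ℝ (Y × X) :=
  ⟨fun z => hp.1 _, by
    rw [← hp.2]
    exact Fintype.sum_equiv (Equiv.prodComm Y X) _ _ fun z => rfl⟩

theorem neg_envelope_sub_envelope_le (hp : p ∈ stdSimplex ℝ (X × Y)) {εA εB : ℝ}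
    (hN : NashAchievable u p εA εB) :
    -upperConcaveEnvelope (valueA fun b a => -u a b) (condEntropy fun z : Y × X => p (z.2, z.1)) -
      upperConcaveEnvelope (valueA u) (condEntropy p) ≤ εA + εB := by
  obtain ⟨M, -, hu⟩ := exists_abs_le u
  have hu' : ∀ b a, |-u a b| ≤ M := fun b a => by rw [abs_neg]; exact hu a b
  have hp' := prodSwap_mem_stdSimplex hp
  refine le_of_forall_pos_le_add fun η hη => ?_
  obtain ⟨n₀, hn₀⟩ := hN (η / 4) (by positivity)
  obtain ⟨n, hn, σ, τ, hA, hB⟩ : ∃ n : ℕ, (0 : ℝ) < n ∧ ∃ σ : Strategy A B X A n,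
      ∃ τ : Strategy A B Y B n, IsApproxNash u p (εA + η / 4) (εB + η / 4) σ τ :=
    ⟨n₀ + 1, by positivity, hn₀ _ (Nat.le_succ _)⟩
  obtain ⟨c, d, hc, hcd, hlt⟩ := exists_affine_ge_securityA hu (condEntropy_nonneg hp.1)
    (lt_add_of_pos_right _ (show 0 < η / 4 by positivity))
  obtain ⟨c', d', hc', hcd', hlt'⟩ := exists_affine_ge_securityA hu' (condEntropy_nonneg hp'.1)
    (lt_add_of_pos_right _ (show 0 < η / 4 by positivity))
  obtain ⟨τ', hτ'⟩ := exists_totalPayoff_le hp hc hcd σ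
  obtain ⟨σ', hσ'⟩ := exists_totalPayoff_le hp' hc' hcd' τ.swap
  have hswap := totalPayoff_swap u p σ'.swap τ
  rw [Strategy.swap_swap] at hswap
  rw [hswap] at hσ'
  have h1 := hA σ'.swap
  have h2 := hB τ'
  simp only [expectedPayoff_eq u hp.2, ← mul_sub, one_div, inv_mul_le_iff₀ hn] at h1 h2
  have h3 := mul_le_mul_of_nonneg_left hlt.le hn.le
  have h4 := mul_le_mul_of_nonneg_left hlt'.le hn.le
  refine le_of_mul_le_mul_left ?_ hn
  linarith

/-- If `J + J' > 0`, letting both players use their securing strategies would, for large `n`,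
guarantee payoffs with positive sum in a zero-sum game. -/
theorem envelope_le_neg_envelope (hp : p ∈ stdSimplex ℝ (X × Y)) :
    upperConcaveEnvelope (valueA u) (condEntropy p) ≤
      -upperConcaveEnvelope (valueA fun b a => -u a b)
        (condEntropy fun z : Y × X => p (z.2, z.1)) := by
  set J := upperConcaveEnvelope (valueA u) (condEntropy p)
  set J' := upperConcaveEnvelope (valueA fun b a => -u a b)
    (condEntropy fun z : Y × X => p (z.2, z.1))
  by_contra! hlt
  obtain ⟨C, hC⟩ := exists_securing_strategy (u := u) hp (show 0 < (J + J') / 4 by linarith)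
  obtain ⟨C', hC'⟩ := exists_securing_strategy (u := fun b a => -u a b)
    (prodSwap_mem_stdSimplex hp) (show 0 < (J + J') / 4 by linarith)
  obtain ⟨n, hn⟩ := exists_nat_gt ((C + C') / ((J + J') / 2))
  rw [div_lt_iff₀ (by linarith)] at hn
  obtain ⟨σ, hσ⟩ := hC n
  obtain ⟨τ, hτ⟩ := hC' n
  have h1 := hσ τ.swap
  have h2 := hτ σ.swap
  have h3 := totalPayoff_swap u p σ τ.swap
  rw [Strategy.swap_swap] at h3
  rw [h3] at h2
  linarith

theorem nashAchievable_of_le (hp : p ∈ stdSimplex ℝ (X × Y)) {εA εB : ℝ} (hA : 0 ≤ εA)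
    (hB : 0 ≤ εB)
    (hle : -upperConcaveEnvelope (valueA fun b a => -u a b)
        (condEntropy fun z : Y × X => p (z.2, z.1)) -
      upperConcaveEnvelope (valueA u) (condEntropy p) ≤ εA + εB) :
    NashAchievable u p εA εB := by
  intro δ hδ
  obtain ⟨M, -, hu⟩ := exists_abs_le u
  have hu' : ∀ b a, |-u a b| ≤ M := fun b a => by rw [abs_neg]; exact hu a b
  have hp' := prodSwap_mem_stdSimplex hp
  obtain ⟨C, hC⟩ := exists_securing_strategy (u := u) hp (half_pos hδ)
  obtain ⟨C', hC'⟩ := exists_securing_strategy (u := fun b a => -u a b) hp' (half_pos hδ)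
  have hJJ := envelope_le_neg_envelope (u := u) hp
  obtain ⟨a₁, b₁, h₁⟩ := exists_payoff_le_envelope hu (condEntropy_nonneg hp.1)
  obtain ⟨b₂, a₂, h₂⟩ := exists_payoff_le_envelope hu' (condEntropy_nonneg hp'.1)
  have hJM := (sustainable_of_lt_envelope hu (condEntropy_nonneg hp.1)
    (sub_lt_self _ (half_pos hδ))).le_bound hu
  have hJM' := (sustainable_of_lt_envelope hu' (condEntropy_nonneg hp'.1)
    (sub_lt_self _ (half_pos hδ))).le_bound hu'
  set J := upperConcaveEnvelope (valueA u) (condEntropy p)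
  set J' := upperConcaveEnvelope (valueA fun b a => -u a b)
    (condEntropy fun z : Y × X => p (z.2, z.1))
  -- The first two bounds deter deviations at every time; the last two limit the gain from deviating
  -- to `εA` and `εB`.
  obtain ⟨v, hvJ, hvJ', hvA, hvB⟩ : ∃ v, J ≤ v ∧ v ≤ -J' ∧ -J' - εA ≤ v ∧ v ≤ J + εB :=
    ⟨max J (-J' - εA), le_max_left _ _, max_le hJJ (by linarith), le_max_right _ _,
      max_le (by linarith) (by linarith)⟩
  obtain ⟨c, K, hK⟩ := exists_seq_abs_sum_sub_le (fun d : A × B => u d.1 d.2) (v := v)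
    (x₁ := (a₁, b₁)) (x₂ := (a₂, b₂)) (h₁.trans hvJ) (by linarith)
  choose PA hPA using hC
  choose PB hPB using hC'
  obtain ⟨n₀, hn₀⟩ := exists_nat_gt ((2 * K + |C| + |C'| + 2 * M) / (δ / 2))
  rw [div_lt_iff₀ (half_pos hδ)] at hn₀
  refine ⟨n₀ + 1, fun n hn => ⟨trigger Prod.fst PA n c,
    trigger Prod.snd (fun m => (PB m).swap) n c, ?_⟩⟩
  have hnn : (n₀ : ℝ) ≤ n := by exact_mod_cast (Nat.le_succ n₀).trans hn
  have hnpos : (0 : ℝ) < n := by exact_mod_cast (Nat.succ_pos n₀).trans_le hn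
  have hconst : 2 * K + |C| + |C'| + 2 * M ≤ n * (δ / 2) :=
    hn₀.le.trans (mul_le_mul_of_nonneg_right hnn (half_pos hδ).le)
  have hpath := totalPayoff_trigger (u := u) hp.2 PA (fun m => (PB m).swap) n c
  have hKn := abs_le.1 (hK n)
  have hC0 := abs_nonneg C
  have hC0' := abs_nonneg C'
  constructor
  · intro σ'
    -- Alice's deviation is handled in the exchanged game, where Bob is the one who secures `J'`.
    have hdev := le_totalPayoff_trigger hp' hu' hJM' (PA := PB) (D := |C'|)
      (fun m τ => le_trans (by linarith [le_abs_self C']) (hPB m τ)) n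
      (c := fun i => (c i).swap) (K := K) (fun k => by
        have h3 := (abs_le.1 (hK k)).2
        have h4 := mul_le_mul_of_nonneg_left (show v ≤ -(J' - δ / 2) by linarith)
          (show (0 : ℝ) ≤ k by positivity)
        simp only [Prod.fst_swap, Prod.snd_swap, Finset.sum_neg_distrib]
        linarith) hC0' σ'.swap
    have hsw := swap_trigger Prod.snd (fun m => (PB m).swap) n c
    simp only [Prod.snd_swap, Strategy.swap_swap] at hsw
    have hsw' := totalPayoff_swap u p σ' (trigger Prod.snd (fun m => (PB m).swap) n c)
    rw [hsw] at hsw'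
    have h5 := hdev.trans_eq hsw'
    rw [expectedPayoff_eq u hp.2, expectedPayoff_eq u hp.2, hpath, ← mul_sub, one_div,
      inv_mul_le_iff₀ hnpos]
    have h6 := mul_le_mul_of_nonneg_left hvA hnpos.le
    linarith
  · intro τ'
    have hdev := le_totalPayoff_trigger hp hu hJM (PA := PA) (D := |C|)
      (fun m τ => le_trans (by linarith [le_abs_self C]) (hPA m τ)) n
      (c := c) (K := K) (fun k => by
        have h3 := (abs_le.1 (hK k)).1
        have h4 := mul_le_mul_of_nonneg_left (show J - δ / 2 ≤ v by linarith)
          (show (0 : ℝ) ≤ k by positivity)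
        linarith) hC0 τ'
    rw [expectedPayoff_eq u hp.2, expectedPayoff_eq u hp.2, hpath, ← mul_sub, one_div,
      inv_mul_le_iff₀ hnpos]
    have h6 := mul_le_mul_of_nonneg_left hvB hnpos.le
    linarith

end Main

end LeakedGame

theorem mainTheorem8 {A B X Y : Type*} [Fintype A] [Fintype B] [Fintype X] [Fintype Y]
    [Nonempty A] [Nonempty B] (u : A → B → ℝ) (p : X × Y → ℝ) (hp : p ∈ stdSimplex ℝ (X × Y))
    (εA εB : ℝ) (hA : 0 ≤ εA) (hB : 0 ≤ εB) :
    LeakedGame.NashAchievable u p εA εB ↔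
      εA + εB ≥
        LeakedGame.lowerConvexEnvelope (LeakedGame.valueB u)
            (LeakedGame.condEntropy fun z : Y × X => p (z.2, z.1)) -
          LeakedGame.upperConcaveEnvelope (LeakedGame.valueA u) (LeakedGame.condEntropy p) := by
  rw [LeakedGame.valueB_eq, LeakedGame.lowerConvexEnvelope_eq]
  simp only [neg_neg]
  exact ⟨LeakedGame.neg_envelope_sub_envelope_le hp, LeakedGame.nashAchievable_of_le hp hA hB⟩
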